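/- A Steiner quadruple system $\mathrm{SQS}(v)$ is a pair $(X,\mathcal B)$ with $|X|=v$ and $\mathcal B$ a set of $4$-element subsets (blocks) of $X$ such that every $3$-element subset of $X$ lies in exactly one block. It admits a $1$-ocycle ($1$-overlap cycle) if its blocks, each used exactly once and each written as a string of its four points in some order, can be arranged in a (nonempty) cyclic sequence such that the last letter of each string is the first letter of the next one. Theorem. Let $(X,\mathcal B)$ be an $\mathrm{SQS}(n)$ with $n\equiv 10\pmod{12}$ that admits a $1$-ocycle. Then there exists an $\mathrm{SQS}(3n-4)$ that admits a $1$-ocycle. More precisely, Hanani's fourth construction yields such a system. Write $n=12k+10$, identify $X$ in any way with $\mathbb Z_{n-2}\cup\{A_0,A_1\}$, and let $Y=(\{0,1,2\}\times\mathbb Z_{n-2})\cup\{A_0,A_1\}$, writing $ij$ for the point $(i,j)$ and adding first coordinates modulo $3$. There exist systems $P_0,\dots,P_{n-4}$ of unordered pairs, each a partition of $\mathbb Z_{n-2}$ into pairs, such that every pair of distinct elements of $\mathbb Z_{n-2}$ lies in exactly one $P_\alpha$, and such that $P_0,\dots,P_{4k+1}$ together consist of exactly the pairs with difference $\pm1,\pm3,\dots,\pm(4k+1)$.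 For every such choice of the $P_\alpha$, the following blocks form an $\mathrm{SQS}(3n-4)$ on $Y$ that admits a $1$-ocycle: 1. $\{ix,iy,iz,it\}$ for $\{x,y,z,t\}\in\mathcal B$ and $i\in\{0,1,2\}$, where the prefix $i$ is omitted at $A_0$ and $A_1$; 2. $\{A_{a_1},0a_2,1a_3,2a_4\}$ with $a_1\in\{0,1\}$, $a_2,a_3,a_4\in\mathbb Z_{n-2}$ and $a_1+a_2+a_3+a_4\equiv0\pmod{n-2}$; 3. $\{(i+2)b_3,\ i(b_1+2k+1+i(4k+2)-d),\ i(b_1+2k+2+i(4k+2)+d),\ (i+1)b_2\}$ with $i\in\{0,1,2\}$, $b_1,b_2,b_3\in\mathbb Z_{n-2}$, $b_1+b_2+b_3\equiv0\pmod{n-2}$ and $d\in\{0,\dots,2k\}$; 4. $\{ir,is,(i+1)r',(i+1)s'\}$ with $i\in\{0,1,2\}$, $4k+2\le\alpha\le12k+6$ and $\{r,s\},\{r',s'\}\in P_\alpha$ (possibly the same pair). -/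

import Mathlib

/-- `B` is the block set of a Steiner quadruple system of order `v` on the point set `X`:
`X` has `v` points, every block has four points, and every three points lie in exactly one
block. -/
structure IsSQS {X : Type*} (v : ℕ) (B : Set (Finset X)) : Prop where
  finite : Finite X
  card_points : Nat.card X = v
  card_block : ∀ b ∈ B, b.card = 4
  existsUnique_block : ∀ t : Finset X, t.card = 3 → ∃! b, b ∈ B ∧ t ⊆ b

/-- The words `W 0, …, W (N - 1)`, cyclically ordered, form an `s`-overlap cycle for the block
set `B`: every word lists the points of one block, each point once; every block is listed by
exactly one word; and the last `s` letters of each word are the first `s` letters of the next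
one (the successor of `W (N - 1)` being `W 0`). -/
structure IsOverlapCycle {X : Type*} [DecidableEq X] (s : ℕ) (B : Set (Finset X)) {N : ℕ}
    (W : Fin N → List X) : Prop where
  pos : 0 < N
  nodup : ∀ i, (W i).Nodup
  bijOn : Set.BijOn (fun i => (W i).toFinset) Set.univ B
  overlap : ∀ i, (W i).drop ((W i).length - s) = (W (finRotate N i)).take s

/-- The block set `B` admits an `s`-overlap cycle (an `s`-ocycle). -/
def AdmitsOcycle {X : Type*} [DecidableEq X] (s : ℕ) (B : Set (Finset X)) : Prop :=
  ∃ (N : ℕ) (W : Fin N → List X), IsOverlapCycle s B W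

/-- The labels `{0, …, n - 3} ∪ {A0, A1}` of the points of an SQS of order `n`. -/
abbrev OldPoint (n : ℕ) : Type := ZMod (n - 2) ⊕ Fin 2

/-- The point set `({0, 1, 2} × {0, …, n - 3}) ∪ {A0, A1}`. -/
abbrev NewPoint (n : ℕ) : Type := (Fin 3 × ZMod (n - 2)) ⊕ Fin 2

/-- The points `A0` and `A1`. -/
def ptA {n : ℕ} (h : Fin 2) : NewPoint n := Sum.inr h

/-- The point `ij` with `i ∈ {0, 1, 2}` and `j ∈ {0, …, n - 3}` (taken modulo `n - 2`). -/
def pt {n : ℕ} (i : Fin 3) (j : ZMod (n - 2)) : NewPoint n := Sum.inl (i, j)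

/-- Prefix a point by `i`; the points `A0` and `A1` are left as they are. -/
def prefixPoint {n : ℕ} (i : Fin 3) : OldPoint n → NewPoint n
  | Sum.inl j => pt i j
  | Sum.inr h => ptA h

/-- `P 0, …, P (M - 2)` are systems of unordered pairs as in Hanani's constructions: each is a
partition of the `M` points of `ZMod M` into pairs, every pair of distinct points lies in exactly
one of them, and the first `c` systems consist of the pairs whose difference is one of
`±1, ±3, ±5, …` with odd absolute value below `c`. -/
structure IsPairSystem (M c : ℕ) (P : ℕ → Set (Sym2 (ZMod M))) : Prop where
  loopless : ∀ α < M - 1, ∀ x, s(x, x) ∉ P α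
  matching : ∀ α < M - 1, ∀ x, ∃! y, s(x, y) ∈ P α
  factorization : ∀ x y, x ≠ y → ∃! α, α < M - 1 ∧ s(x, y) ∈ P α
  low : ∀ α < M - 1, ∀ x y, s(x, y) ∈ P α →
    (α < c ↔ ∃ d : ℕ, 2 * d + 1 < c ∧
      (y = x + ((2 * d + 1 : ℕ) : ZMod M) ∨ x = y + ((2 * d + 1 : ℕ) : ZMod M)))

/-- The blocks of Hanani's fourth construction for `n = 12 k + 10`, starting from the blocks `B`
on `{0, …, n - 3} ∪ {A0, A1}` and from the pair systems `P`. The four clauses are the four types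
of blocks. -/
def fourthConstruction (n k : ℕ) (B : Set (Finset (OldPoint n)))
    (P : ℕ → Set (Sym2 (ZMod (n - 2)))) : Set (Finset (NewPoint n)) :=
  {b | ∃ i : Fin 3, ∃ b₀ ∈ B, b = b₀.image (prefixPoint i)} ∪
  {b | ∃ (a₁ : Fin 2) (a₂ a₃ a₄ : ZMod (n - 2)),
    (a₁.val : ZMod (n - 2)) + a₂ + a₃ + a₄ = 0 ∧
    b = {ptA a₁, pt 0 a₂, pt 1 a₃, pt 2 a₄}} ∪
  {b | ∃ (i : Fin 3) (b₁ b₂ b₃ : ZMod (n - 2)) (d : ℕ),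
    b₁ + b₂ + b₃ = 0 ∧ d ≤ 2 * k ∧
    b = {pt (i + 2) b₃,
      pt i (b₁ + ((2 * k + 1 + i.val * (4 * k + 2) : ℕ) : ZMod (n - 2)) - (d : ZMod (n - 2))),
      pt i (b₁ + ((2 * k + 2 + i.val * (4 * k + 2) : ℕ) : ZMod (n - 2)) + (d : ZMod (n - 2))),
      pt (i + 1) b₂}} ∪
  {b | ∃ (i : Fin 3) (α : ℕ) (r s r' s' : ZMod (n - 2)),
    4 * k + 2 ≤ α ∧ α ≤ 12 * k + 6 ∧ s(r, s) ∈ P α ∧ s(r', s') ∈ P α ∧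
    b = {pt i r, pt i s, pt (i + 1) r', pt (i + 1) s'}}

/-- The block set obtained from `B` by naming its points through `e`. -/
def relabel {X : Type*} {n : ℕ} (e : X ≃ OldPoint n) (B : Set (Finset X)) :
    Set (Finset (OldPoint n)) :=
  (fun b => b.map e.toEmbedding) '' B

/-! Overlap cycle: pick a first and a last point in each block and view the block as an arc from one
to the other. A `1`-overlap cycle is an Euler circuit of this directed multigraph. As in Euler's
theorem, it suffices to split the arcs into closed walks (a permutation `next` with `head e = tail
(next e)`) and to have connectedness: two closed walks through a common point are spliced by a
transposition, which is `BlockTour.exists_sameCycle`. `BlockTour.admitsOcycle` turns the single walk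
into words.

For the new system the closed walks are explicit. Each layer carries a copy of the old tour. The two
blocks of type 2 with the same points in layers 0 and 1 form a 2-cycle. With `i`, `d` and the point
in layer `i + 1` fixed, the blocks of type 3 are walked by adding the odd difference `2 * d + 1`.
For type 4, the pairs are exchanged while `i` goes to `i + 1`. Type 2 joins all points of layers 0
and 1, differences 1 join layer 2 internally, a block of type 4 joins layers 1 and 2, and every
copied tour touches its layer.

Steiner property (`inUniqueBlock`): three points in one layer, or two of them with some `A`, or
`A₀`, `A₁` and a point, are covered by the old system. An `A` with points in two layers is covered
by type 2. Two points of a layer and one of another are covered by type 3 if their difference is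
`±1, ±3, …, ±(4k+1)`, and by type 4 otherwise. A triple with one point in each layer is sorted by
its sum modulo `12k + 8`: the sums `0` and `-1` belong to type 2, and each of `1, …, 12k + 6` to
exactly one choice of `i`, `d` and a point of the pair in type 3. -/

/-- An indexing of the blocks of `C` by `E`, together with a choice of an ordered pair
`(tail e, head e)` of distinct points in every block and a permutation `next` of the blocks that
leads from every block to one whose tail is the head of the former. The multigraph formed by the
chosen pairs is connected. -/
structure BlockTour {Y : Type*} (C : Set (Finset Y)) (E : Type*) where
  blk : E → Finset Y
  bijOn : Set.BijOn blk Set.univ C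
  tail : E → Y
  head : E → Y
  tail_mem : ∀ e, tail e ∈ blk e
  head_mem : ∀ e, head e ∈ blk e
  tail_ne_head : ∀ e, tail e ≠ head e
  next : Equiv.Perm E
  head_eq : ∀ e, head e = tail (next e)
  connected : ∀ T : Set Y, (∀ e, tail e ∈ T ↔ head e ∈ T) → ∀ e e', tail e ∈ T → tail e' ∈ T

/-! ### Euler circuits by merging cycles -/

/-- Composing a permutation with a transposition of points of two different cycles merges these
cycles. -/
theorem sameCycle_swap_mul {E : Type*} [Finite E] [DecidableEq E] {τ : Equiv.Perm E} {e e' : E}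
    (h : ¬ τ.SameCycle e e') :
    (∀ x, τ.SameCycle e x → (Equiv.swap e e' * τ).SameCycle e x) ∧
      (Equiv.swap e e' * τ).SameCycle e e' := by
  set τ' := Equiv.swap e e' * τ with hτ'
  have incl : ∀ x, τ.SameCycle e x → τ'.SameCycle e x := by
    intro x hx
    obtain ⟨j, rfl⟩ := hx.exists_nat_pow_eq
    clear hx
    induction j with
    | zero => exact Equiv.Perm.SameCycle.refl _ _
    | succ j ih =>
      -- The orbit of `e` under `τ` never meets `e'`, so the swap changes nothing until the orbit
      -- returns to `e`.
      by_cases h1 : (τ ^ (j + 1)) e = e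
      · rw [h1]
      · have h2 : (τ ^ (j + 1)) e ≠ e' := fun h3 => h ⟨(j + 1 : ℕ), by rw [zpow_natCast, h3]⟩
        have h4 : τ' ((τ ^ j) e) = (τ ^ (j + 1)) e := by
          rw [hτ', Equiv.Perm.mul_apply, ← Equiv.Perm.mul_apply τ, ← pow_succ',
            Equiv.swap_apply_of_ne_of_ne h1 h2]
        rw [← h4]
        exact Equiv.Perm.sameCycle_apply_right.2 ih
  refine ⟨incl, ?_⟩
  have h5 : τ' (τ.symm e) = e' := by simp [hτ']
  rw [← h5]
  exact Equiv.Perm.sameCycle_apply_right.2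
    (incl _ (Equiv.Perm.sameCycle_symm_apply_right.2 (Equiv.Perm.SameCycle.refl _ _)))

namespace BlockTour

variable {Y E : Type*} {C : Set (Finset Y)}

/-- The blocks of a tour can be traversed in a single cycle. -/
theorem exists_sameCycle [Finite E] (t : BlockTour C E) (e₀ : E) :
    ∃ τ : Equiv.Perm E, (∀ e, t.head e = t.tail (τ e)) ∧ ∀ e, τ.SameCycle e₀ e := by
  classical
  have : Nonempty {τ : Equiv.Perm E // ∀ e, t.head e = t.tail (τ e)} := ⟨⟨t.next, t.head_eq⟩⟩
  -- Among all admissible successor permutations, take one whose cycle through `e₀` is longest; a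
  -- block outside it sharing a tail with a block inside could be merged in.
  obtain ⟨⟨τ, hτ⟩, hmax⟩ := Finite.exists_max
    fun τ : {τ : Equiv.Perm E // ∀ e, t.head e = t.tail (τ e)} =>
      {e | τ.1.SameCycle e₀ e}.ncard
  refine ⟨τ, hτ, ?_⟩
  have merge : ∀ e e', t.tail e = t.tail e' → τ.SameCycle e₀ e → τ.SameCycle e₀ e' := by
    intro e e' hee he
    by_contra he'
    obtain ⟨h1, h2⟩ := sameCycle_swap_mul (τ := τ) (e := e) (e' := e')
      fun h => he' (he.trans h)
    have h3 : ∀ x, t.head x = t.tail ((Equiv.swap e e' * τ) x) := by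
      intro x
      rw [hτ x, Equiv.Perm.mul_apply]
      by_cases h4 : τ x = e
      · rw [h4, Equiv.swap_apply_left, hee]
      · by_cases h5 : τ x = e'
        · rw [h5, Equiv.swap_apply_right, hee]
        · rw [Equiv.swap_apply_of_ne_of_ne h4 h5]
    have h4 := h1 e₀ he.symm
    refine absurd (hmax ⟨_, h3⟩) (not_le.2 (Set.ncard_lt_ncard ⟨?_, ?_⟩ (Set.toFinite _)))
    · exact fun x hx => h4.symm.trans (h1 x (he.symm.trans hx))
    · exact fun hsub => he' (hsub (h4.symm.trans h2))
  have hT : ∀ e, t.tail e ∈ t.tail '' {e | τ.SameCycle e₀ e} ↔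
      t.head e ∈ t.tail '' {e | τ.SameCycle e₀ e} := by
    intro e
    constructor
    · rintro ⟨e', he', h⟩
      exact ⟨τ e, Equiv.Perm.sameCycle_apply_right.2 (merge _ _ h he'), (hτ e).symm⟩
    · rintro ⟨e', he', h⟩
      refine ⟨e, Equiv.Perm.sameCycle_apply_right.1 (merge _ _ (h.trans (hτ e)) he'), rfl⟩
  intro e
  obtain ⟨e', he', h⟩ := t.connected _ hT e₀ e ⟨e₀, Equiv.Perm.SameCycle.refl _ _, rfl⟩
  exact merge _ _ h he'

/-- A tour yields a `1`-overlap cycle: start the word of every block with its tail and end it with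
its head. -/
theorem admitsOcycle [DecidableEq Y] [Finite E] [Nonempty E] (t : BlockTour C E) :
    AdmitsOcycle 1 C := by
  classical
  have := Fintype.ofFinite E
  obtain ⟨e₀⟩ := ‹Nonempty E›
  obtain ⟨τ, hτ, hcyc⟩ := t.exists_sameCycle e₀
  have hon : τ.IsCycleOn (Finset.univ : Finset E) := by
    refine ⟨by simp, ?_⟩
    exact fun x _ y _ => (hcyc x).symm.trans (hcyc y)
  set N := Fintype.card E with hN
  have hcard : (Finset.univ : Finset E).card = N := Finset.card_univ
  have hpos : 0 < N := Fintype.card_pos_iff.2 ⟨e₀⟩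
  let word : E → List Y := fun e =>
    t.tail e :: ((((t.blk e).erase (t.tail e)).erase (t.head e)).toList ++ [t.head e])
  have hword : ∀ e, (word e).toFinset = t.blk e := by
    intro e
    ext y
    have h1 := t.tail_mem e
    have h2 := t.head_mem e
    simp only [word, List.toFinset_cons, List.toFinset_append, Finset.toList_toFinset,
      List.toFinset_nil, Finset.mem_insert, Finset.mem_union, Finset.mem_erase,
      Finset.notMem_empty, or_false]
    grind
  let f : Fin N → E := fun i => (τ ^ (i : ℕ)) e₀
  have hf : Function.Bijective f := by
    refine (Fintype.bijective_iff_surjective_and_card f).2 ⟨fun e => ?_, by simp [hN]⟩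
    obtain ⟨j, hj, h⟩ := hon.exists_pow_eq (Finset.mem_univ e₀) (Finset.mem_univ e)
    exact ⟨⟨j, hcard ▸ hj⟩, h⟩
  have hnext : ∀ i, f (finRotate N i) = τ (f i) := by
    intro i
    have : NeZero N := ⟨hpos.ne'⟩
    rw [finRotate_apply]
    change (τ ^ ((i + 1 : Fin N) : ℕ)) e₀ = τ ((τ ^ (i : ℕ)) e₀)
    rw [← Equiv.Perm.mul_apply, ← pow_succ',
      hon.pow_apply_eq_pow_apply (Finset.mem_univ e₀), hcard, Fin.val_add_eq_ite,
      Fin.val_one']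
    -- In `Fin 1` the value of `1` is `0`, so this case is separate; otherwise the only wrap-around
    -- is from `N - 1` to `0`.
    by_cases h1 : N = 1
    · simp [h1, Nat.modEq_one]
    · rw [Nat.mod_eq_of_lt (show 1 < N by omega)]
      split_ifs with h
      · exact (Nat.modEq_iff_dvd' (by omega)).2 ⟨1, by omega⟩
      · rfl
  refine ⟨N, fun i => word (f i), hpos, fun i => ?_, ?_, fun i => ?_⟩
  · have h1 := t.tail_ne_head (f i)
    simp only [word, List.nodup_cons, List.nodup_append, List.mem_append, Finset.mem_toList,
      Finset.mem_erase, Finset.nodup_toList]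
    simpa [h1] using fun a h _ _ => h
  · simp only [hword]
    exact t.bijOn.comp hf.bijOn_univ
  · simp only [word, hnext]
    simp [← hτ]

end BlockTour

/-- A `1`-overlap cycle of blocks with four points is a tour. -/
theorem AdmitsOcycle.exists_blockTour {Y : Type*} [DecidableEq Y] {C : Set (Finset Y)}
    (h : AdmitsOcycle 1 C) (h4 : ∀ b ∈ C, b.card = 4) :
    ∃ N : ℕ, Nonempty (BlockTour C (Fin N)) := by
  obtain ⟨N, W, hW⟩ := h
  have hlen : ∀ i, (W i).length = 4 := by
    intro i
    rw [← List.toFinset_card_of_nodup (hW.nodup i)]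
    exact h4 _ (hW.bijOn.mapsTo (Set.mem_univ i))
  have hN := hW.pos
  have hover : ∀ i, (W i)[3]'(by simp [hlen]) = (W (finRotate N i))[0]'(by simp [hlen]) := by
    intro i
    have h1 := congrArg (fun l : List Y => l[0]?) (hW.overlap i)
    simpa [hlen, List.getElem?_drop, List.getElem?_take] using h1
  refine ⟨N, ⟨⟨fun i => (W i).toFinset, hW.bijOn, fun i => (W i)[0]'(by simp [hlen]),
    fun i => (W i)[3]'(by simp [hlen]), ?_, ?_, ?_, finRotate N, hover, ?_⟩⟩⟩
  · intro i; simp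
  · intro i; simp
  · intro i hi
    have := (hW.nodup i).getElem_inj_iff.1 hi
    omega
  · intro T hT
    obtain ⟨m, rfl⟩ : ∃ m, N = m + 1 := ⟨N - 1, by omega⟩
    -- Consecutive words share a letter, so membership in `T` is carried along the whole cycle.
    have h0 : ∀ i : Fin (m + 1), (W i)[0]'(by simp [hlen]) ∈ T ↔ (W 0)[0]'(by simp [hlen]) ∈ T := by
      intro i
      induction i using Fin.induction with
      | zero => rfl
      | succ i ih =>
        rw [← ih, hT i.castSucc, hover]
        simp
    intro e e' he
    exact (h0 e').2 ((h0 e).1 he)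

/-! ### One-factorizations containing the small odd differences -/

/-- The colour of the pair `{p, q}`, `p < q < 2 * h + 2`, in a one-factorization of the complete
graph on `2 * (h + 1)` vertices. A pair with odd difference is coloured by this difference and the parity
of its starting point; the pairs with even difference are coloured by the round robin scheme on
the even and on the odd numbers. -/
def pairColourLT (h p q : ℕ) : ℕ :=
  if (q - p) % 2 = 1 then
    if q - p < h + 1 then q - p - 1 + p % 2 else 2 * h + 2 - (q - p) - 1 + q % 2
  else h + 1 +
    if q / 2 = h then (if 2 * (p / 2) < h then 2 * (p / 2) else 2 * (p / 2) - h)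
    else if p / 2 + q / 2 < h then p / 2 + q / 2 else p / 2 + q / 2 - h

/-- The symmetric extension of `pairColourLT`. -/
def pairColour (h p q : ℕ) : ℕ :=
  if p < q then pairColourLT h p q else pairColourLT h q p

theorem pairColour_comm (h p q : ℕ) : pairColour h p q = pairColour h q p := by
  unfold pairColour
  rcases lt_trichotomy p q with h1 | rfl | h1
  · rw [if_pos h1, if_neg (by omega)]
  · rfl
  · rw [if_neg (by omega), if_pos h1]

theorem pairColourLT_lt {h p q : ℕ} (hh : h % 2 = 1) (hpq : p < q) (hq : q < 2 * h + 2) :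
    pairColourLT h p q < 2 * h + 1 := by
  unfold pairColourLT
  split_ifs <;> omega

theorem pairColour_lt {h p q : ℕ} (hh : h % 2 = 1) (hpq : p ≠ q) (hp : p < 2 * h + 2)
    (hq : q < 2 * h + 2) : pairColour h p q < 2 * h + 1 := by
  unfold pairColour
  split_ifs
  · exact pairColourLT_lt hh ‹_› hq
  · exact pairColourLT_lt hh (by omega) hp

theorem pairColourLT_lt_iff {h p q : ℕ} (hh : h % 2 = 1) (hpq : p < q) (hq : q < 2 * h + 2) :
    pairColourLT h p q < h + 1 ↔ (q - p) % 2 = 1 := by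
  unfold pairColourLT
  split_ifs <;> omega

theorem pairColour_lt_iff {h p q : ℕ} (hh : h % 2 = 1) (hpq : p ≠ q) (hp : p < 2 * h + 2)
    (hq : q < 2 * h + 2) : pairColour h p q < h + 1 ↔ (p + q) % 2 = 1 := by
  unfold pairColour
  split_ifs
  · rw [pairColourLT_lt_iff hh ‹_› hq]; omega
  · rw [pairColourLT_lt_iff hh (by omega) hp]; omega

/-- For an odd cyclic distance, the colour fixes the distance and the parity of the starting point,
hence whether to move forwards or backwards from `p`. For even distance, the colour is a sum modulo
the odd number `h` within one parity class, with the last element playing infinity; there doubling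
is injective. -/
theorem pairColour_inj {h p q r : ℕ} (hh : h % 2 = 1) (hpq : p ≠ q) (hpr : p ≠ r)
    (hp : p < 2 * h + 2) (hq : q < 2 * h + 2) (hr : r < 2 * h + 2)
    (heq : pairColour h p q = pairColour h p r) : q = r := by
  have h1 := pairColour_lt_iff hh hpq hp hq
  rw [heq, pairColour_lt_iff hh hpr hp hr] at h1
  unfold pairColour pairColourLT at heq
  rcases Nat.mod_two_eq_zero_or_one (p + q) with h2 | h2
  · have h3 : ¬ (q - p) % 2 = 1 := by omega
    have h4 : ¬ (p - q) % 2 = 1 := by omega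
    have h5 : ¬ (r - p) % 2 = 1 := by omega
    have h6 : ¬ (p - r) % 2 = 1 := by omega
    simp only [h3, h4, h5, h6, if_false] at heq
    obtain ⟨a, c, hc, rfl⟩ : ∃ a c, c < 2 ∧ p = 2 * a + c := ⟨p / 2, p % 2, by omega, by omega⟩
    obtain ⟨b, rfl⟩ : ∃ b, q = 2 * b + c := ⟨q / 2, by omega⟩
    obtain ⟨d, rfl⟩ : ∃ d, r = 2 * d + c := ⟨r / 2, by omega⟩
    have e1 : (2 * a + c) / 2 = a := by omega
    have e2 : (2 * b + c) / 2 = b := by omega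
    have e3 : (2 * d + c) / 2 = d := by omega
    rw [e1, e2, e3] at heq
    split_ifs at heq <;> omega
  · rcases lt_or_gt_of_ne hpq with h7 | h7 <;> rcases lt_or_gt_of_ne hpr with h8 | h8
    · have h3 : (q - p) % 2 = 1 := by omega
      have h5 : (r - p) % 2 = 1 := by omega
      simp only [h3, h5, h7, h8, if_true] at heq
      split_ifs at heq <;> omega
    · have h3 : (q - p) % 2 = 1 := by omega
      have h5 : (p - r) % 2 = 1 := by omega
      simp only [h3, h5, h7, not_lt_of_gt h8, if_true, if_false] at heq
      split_ifs at heq <;> omega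
    · have h3 : (p - q) % 2 = 1 := by omega
      have h5 : (r - p) % 2 = 1 := by omega
      simp only [h3, h5, not_lt_of_gt h7, h8, if_true, if_false] at heq
      split_ifs at heq <;> omega
    · have h3 : (p - q) % 2 = 1 := by omega
      have h5 : (p - r) % 2 = 1 := by omega
      simp only [h3, h5, not_lt_of_gt h7, not_lt_of_gt h8, if_true, if_false] at heq
      split_ifs at heq <;> omega

/-- Pair systems exist: the first systems are read off from the colouring `pairColour`. -/
theorem exists_isPairSystem (M k : ℕ) (hM : M = 12 * k + 8) :
    ∃ P : ℕ → Set (Sym2 (ZMod M)), IsPairSystem M (4 * k + 2) P := by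
  have : NeZero M := ⟨by omega⟩
  set h := 6 * k + 3 with hh
  have hh2 : h % 2 = 1 := by omega
  have hMh : M = 2 * h + 2 := by omega
  have hlt : ∀ x : ZMod M, x.val < 2 * h + 2 := fun x => hMh ▸ x.val_lt
  have hval : ∀ {x y : ZMod M}, x ≠ y → x.val ≠ y.val :=
    fun hxy h => hxy (ZMod.val_injective M h)
  let P : ℕ → Set (Sym2 (ZMod M)) := fun α =>
    {p | ∃ x y, x ≠ y ∧ p = s(x, y) ∧ pairColour h x.val y.val = α}
  have hP : ∀ α x y, s(x, y) ∈ P α ↔ x ≠ y ∧ pairColour h x.val y.val = α := by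
    intro α x y
    constructor
    · rintro ⟨x', y', hne, he, hα⟩
      rcases Sym2.eq_iff.1 he with ⟨rfl, rfl⟩ | ⟨rfl, rfl⟩
      · exact ⟨hne, hα⟩
      · exact ⟨hne.symm, by rw [pairColour_comm]; exact hα⟩
    · rintro ⟨hne, hα⟩
      exact ⟨x, y, hne, rfl, hα⟩
  refine ⟨P, ⟨?_, ?_, ?_, ?_⟩⟩
  · intro α _ x hx
    exact ((hP _ _ _).1 hx).1 rfl
  · intro α hα x
    -- At `x` there are as many partners as colours, so injectivity of the colouring already gives a
    -- perfect matching in every colour.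
    let f : {y : ZMod M // y ≠ x} → Fin (M - 1) := fun y =>
      ⟨pairColour h x.val y.1.val, by
        have := pairColour_lt hh2 (hval y.2.symm) (hlt x) (hlt y.1)
        omega⟩
    have hinj : Function.Injective f := by
      intro y z hyz
      have := congrArg Fin.val hyz
      exact Subtype.ext (ZMod.val_injective M (pairColour_inj hh2 (hval y.2.symm)
        (hval z.2.symm) (hlt _) (hlt _) (hlt _) this))
    have hbij : Function.Bijective f := by
      refine (Fintype.bijective_iff_injective_and_card f).2 ⟨hinj, ?_⟩
      simp [ZMod.card]
    obtain ⟨⟨y, hy⟩, hfy⟩ := hbij.2 ⟨α, hα⟩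
    refine ⟨y, (hP _ _ _).2 ⟨hy.symm, congrArg Fin.val hfy⟩, fun z hz => ?_⟩
    obtain ⟨hz1, hz2⟩ := (hP _ _ _).1 hz
    have : f ⟨z, hz1.symm⟩ = f ⟨y, hy⟩ := by
      rw [hfy]; exact Fin.ext hz2
    exact congrArg Subtype.val (hinj this)
  · intro x y hxy
    refine ⟨pairColour h x.val y.val, ⟨?_, (hP _ _ _).2 ⟨hxy, rfl⟩⟩, ?_⟩
    · have := pairColour_lt hh2 (hval hxy) (hlt x) (hlt y)
      omega
    · rintro α ⟨_, hα⟩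
      exact ((hP _ _ _).1 hα).2.symm
  · intro α hα x y hxy
    obtain ⟨hne, rfl⟩ := (hP _ _ _).1 hxy
    have hadd : ∀ (u v : ZMod M) (m : ℕ), m < M →
        (v = u + (m : ZMod M) ↔ v.val = u.val + m ∨ v.val + M = u.val + m) := by
      intro u v m hm
      rw [← (ZMod.val_injective M).eq_iff, ZMod.val_add, ZMod.val_natCast_of_lt hm]
      have h1 := u.val_lt
      have h2 := v.val_lt
      rcases lt_or_ge (u.val + m) M with h3 | h3
      · rw [Nat.mod_eq_of_lt h3]; omega
      · rw [Nat.mod_eq_sub_mod h3, Nat.mod_eq_of_lt (by omega)]; omega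
    have h1 := pairColour_lt_iff hh2 (hval hne) (hlt x) (hlt y)
    have hx := hlt x
    have hy := hlt y
    have hne' := hval hne
    -- An odd cyclic distance `δ ≤ h` owns the colours `δ - 1` and `δ`. As `4 * k + 2` is even and
    -- at most `h + 1`, lying below it depends on `δ` alone.
    constructor
    · intro hc
      have hodd := h1.1 (by omega)
      have hc' := hc
      unfold pairColour pairColourLT at hc'
      rcases lt_or_gt_of_ne hne' with h2 | h2
      · rw [if_pos h2, if_pos (by omega)] at hc'
        split_ifs at hc' with h3
        · exact ⟨(y.val - x.val) / 2, by omega, Or.inl ((hadd _ _ _ (by omega)).2 (by omega))⟩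
        · exact ⟨(M - (y.val - x.val)) / 2, by omega,
            Or.inr ((hadd _ _ _ (by omega)).2 (by omega))⟩
      · rw [if_neg (by omega), if_pos (by omega)] at hc'
        split_ifs at hc' with h3
        · exact ⟨(x.val - y.val) / 2, by omega, Or.inr ((hadd _ _ _ (by omega)).2 (by omega))⟩
        · exact ⟨(M - (x.val - y.val)) / 2, by omega,
            Or.inl ((hadd _ _ _ (by omega)).2 (by omega))⟩
    · rintro ⟨d, hd, hd'⟩
      rw [hadd _ _ _ (by omega), hadd _ _ _ (by omega)] at hd'
      unfold pairColour pairColourLT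
      rcases lt_or_gt_of_ne hne' with h2 | h2
      · rw [if_pos h2, if_pos (by omega)]
        split_ifs <;> omega
      · rw [if_neg (by omega), if_pos (by omega)]
        split_ifs <;> omega

/-! ### Indexed quadruple systems and transport along bijections -/

/-- A system of blocks is a Steiner quadruple system if its blocks can be indexed such that any
three distinct points lie in the block of exactly one index. -/
theorem isSQS_of_existsUnique {Y E : Type*} [DecidableEq Y] [Finite Y] {v : ℕ} {C : Set (Finset Y)}
    {blk : E → Finset Y} (hv : Nat.card Y = v) (hC : Set.range blk = C)
    (h4 : ∀ e, (blk e).card = 4)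
    (h : ∀ x y z, x ≠ y → x ≠ z → y ≠ z → ∃! e, x ∈ blk e ∧ y ∈ blk e ∧ z ∈ blk e) :
    IsSQS v C ∧ Set.BijOn blk Set.univ C := by
  subst hC
  refine ⟨⟨inferInstance, hv, ?_, ?_⟩, ⟨fun e _ => ⟨e, rfl⟩, ?_, ?_⟩⟩
  · rintro _ ⟨e, rfl⟩
    exact h4 e
  · intro t ht
    obtain ⟨x, y, z, hxy, hxz, hyz, rfl⟩ := Finset.card_eq_three.1 ht
    obtain ⟨e, he, he'⟩ := h x y z hxy hxz hyz
    refine ⟨blk e, ⟨⟨e, rfl⟩, ?_⟩, ?_⟩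
    · simpa [Finset.insert_subset_iff] using he
    · rintro _ ⟨⟨e', rfl⟩, hs⟩
      rw [he' e' (by simpa [Finset.insert_subset_iff] using hs)]
  -- Injectivity comes for free: three points of a block already determine the index.
  · intro e _ e' _ hee
    obtain ⟨t, hte, ht⟩ := Finset.exists_subset_card_eq (show 3 ≤ (blk e).card by rw [h4]; omega)
    obtain ⟨x, y, z, hxy, hxz, hyz, rfl⟩ := Finset.card_eq_three.1 ht
    have h1 : x ∈ blk e ∧ y ∈ blk e ∧ z ∈ blk e := by
      simpa [Finset.insert_subset_iff] using hte
    exact (h x y z hxy hxz hyz).unique h1 (hee ▸ h1)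
  · rintro _ ⟨e, rfl⟩
    exact ⟨e, Set.mem_univ _, rfl⟩

theorem IsSQS.map {X Y : Type*} {v : ℕ} {B : Set (Finset X)} (hB : IsSQS v B) (e : X ≃ Y) :
    IsSQS v ((fun b => b.map e.toEmbedding) '' B) := by
  have := hB.finite
  refine ⟨Finite.of_equiv X e, by rw [← Nat.card_congr e, hB.card_points], ?_, ?_⟩
  · rintro _ ⟨b, hb, rfl⟩
    simpa using hB.card_block b hb
  · intro t ht
    have ht' : t = (t.map e.symm.toEmbedding).map e.toEmbedding := by
      ext; simp
    obtain ⟨b, ⟨hb, htb⟩, hu⟩ := hB.existsUnique_block (t.map e.symm.toEmbedding) (by simpa)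
    refine ⟨b.map e.toEmbedding, ⟨⟨b, hb, rfl⟩, ?_⟩, ?_⟩
    · rw [ht']
      exact Finset.map_subset_map.2 htb
    · rintro _ ⟨⟨b', hb', rfl⟩, htb'⟩
      rw [ht'] at htb'
      simp only [hu b' ⟨hb', Finset.map_subset_map.1 htb'⟩]

theorem AdmitsOcycle.map {X Y : Type*} [DecidableEq X] [DecidableEq Y] {s : ℕ}
    {B : Set (Finset X)} (hB : AdmitsOcycle s B) (e : X ≃ Y) :
    AdmitsOcycle s ((fun b => b.map e.toEmbedding) '' B) := by
  obtain ⟨N, W, hW⟩ := hB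
  refine ⟨N, fun i => (W i).map e, hW.pos, fun i => (hW.nodup i).map e.injective, ?_, fun i => ?_⟩
  · have h1 : (fun i => ((W i).map e).toFinset) =
        (fun b : Finset X => b.map e.toEmbedding) ∘ fun i => (W i).toFinset := by
      funext i
      ext y
      simp [← Equiv.eq_symm_apply]
    rw [h1]
    exact ((Finset.map_injective _).injOn.bijOn_image).comp hW.bijOn
  · rw [List.length_map, ← List.map_drop, ← List.map_take, hW.overlap]

/-! ### Indexing the new blocks, and their intersections with layers -/

namespace HananiFourth

variable {n k : ℕ}

@[simp] theorem pt_inj {i j : Fin 3} {x y : ZMod (n - 2)} :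
    (pt i x : NewPoint n) = pt j y ↔ i = j ∧ x = y := by
  simp [pt]

@[simp] theorem ptA_inj {a b : Fin 2} : (ptA a : NewPoint n) = ptA b ↔ a = b := by
  simp [ptA]

@[simp] theorem pt_ne_ptA {i : Fin 3} {x : ZMod (n - 2)} {a : Fin 2} :
    (pt i x : NewPoint n) ≠ ptA a := by
  simp [pt, ptA]

@[simp] theorem ptA_ne_pt {i : Fin 3} {x : ZMod (n - 2)} {a : Fin 2} :
    (ptA a : NewPoint n) ≠ pt i x := by
  simp [pt, ptA]

theorem prefixPoint_injective (i : Fin 3) : Function.Injective (prefixPoint (n := n) i) := by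
  rintro (x | a) (y | b) h
  · simpa [prefixPoint] using h
  · simp [prefixPoint] at h
  · simp [prefixPoint] at h
  · simpa [prefixPoint] using h

/-- An index set for the blocks of the construction, when the blocks of the old system are indexed
by `E₀`. A block of the third type is given by `i`, `d`, the first of its two points in the `i`-th
layer, and its point in the next layer. -/
abbrev Index (n k : ℕ) (E₀ : Type*) (P : ℕ → Set (Sym2 (ZMod (n - 2)))) : Type _ :=
  (Fin 3 × E₀) ⊕ (Fin 2 × ZMod (n - 2) × ZMod (n - 2)) ⊕
    (Fin 3 × Fin (2 * k + 1) × ZMod (n - 2) × ZMod (n - 2)) ⊕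
    (Fin 3 × {q : ℕ × Sym2 (ZMod (n - 2)) × Sym2 (ZMod (n - 2)) //
      (4 * k + 2 ≤ q.1 ∧ q.1 ≤ 12 * k + 6) ∧ q.2.1 ∈ P q.1 ∧ q.2.2 ∈ P q.1})

/-- The sum of the points in the other two layers of a block of the third type with `w` as
its first point in the `i`-th layer is the negative of this number. -/
def base (n k : ℕ) (i : Fin 3) (d : ℕ) (w : ZMod (n - 2)) : ZMod (n - 2) :=
  w - ((2 * k + 1 + i.val * (4 * k + 2) : ℕ) : ZMod (n - 2)) + (d : ZMod (n - 2))

variable {E₀ : Type*} {P : ℕ → Set (Sym2 (ZMod (n - 2)))}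

/-- The block with a given index. -/
def block (B₀ : E₀ → Finset (OldPoint n)) : Index n k E₀ P → Finset (NewPoint n)
  | Sum.inl (i, e) => (B₀ e).image (prefixPoint i)
  | Sum.inr (Sum.inl (a, x, y)) =>
    {ptA a, pt 0 x, pt 1 y, pt 2 (-((a.val : ZMod (n - 2)) + x + y))}
  | Sum.inr (Sum.inr (Sum.inl (i, d, w, b))) =>
    {pt (i + 2) (-(base n k i d w + b)), pt i w, pt i (w + ((2 * d + 1 : ℕ) : ZMod (n - 2))),
      pt (i + 1) b}
  | Sum.inr (Sum.inr (Sum.inr (i, q))) =>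
    q.1.2.1.toFinset.image (pt i) ∪ q.1.2.2.toFinset.image (pt (i + 1))

variable (B₀ : E₀ → Finset (OldPoint n))

@[simp] theorem pt_mem_block₁ {i j : Fin 3} {e : E₀} {x : ZMod (n - 2)} :
    pt j x ∈ block B₀ (Sum.inl (i, e) : Index n k E₀ P) ↔ j = i ∧ Sum.inl x ∈ B₀ e := by
  simp only [block, Finset.mem_image]
  constructor
  · rintro ⟨y | a, hy, h⟩
    · rw [prefixPoint, pt_inj] at h
      obtain ⟨rfl, rfl⟩ := h
      exact ⟨rfl, hy⟩
    · simp [prefixPoint] at h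
  · rintro ⟨rfl, h⟩
    exact ⟨_, h, rfl⟩

@[simp] theorem ptA_mem_block₁ {i : Fin 3} {e : E₀} {a : Fin 2} :
    ptA a ∈ block B₀ (Sum.inl (i, e) : Index n k E₀ P) ↔ Sum.inr a ∈ B₀ e := by
  simp only [block, Finset.mem_image]
  constructor
  · rintro ⟨y | b, hy, h⟩
    · simp [prefixPoint] at h
    · rw [prefixPoint, ptA_inj] at h
      exact h ▸ hy
  · intro h
    exact ⟨_, h, rfl⟩

@[simp] theorem pt_mem_block₂ {j : Fin 3} {a : Fin 2} {x y z : ZMod (n - 2)} :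
    pt j z ∈ block B₀ (Sum.inr (Sum.inl (a, x, y)) : Index n k E₀ P) ↔
      j = 0 ∧ z = x ∨ j = 1 ∧ z = y ∨ j = 2 ∧ z = -((a.val : ZMod (n - 2)) + x + y) := by
  simp [block]

@[simp] theorem ptA_mem_block₂ {a b : Fin 2} {x y : ZMod (n - 2)} :
    ptA b ∈ block B₀ (Sum.inr (Sum.inl (a, x, y)) : Index n k E₀ P) ↔ b = a := by
  simp [block]

@[simp] theorem pt_mem_block₃ {i j : Fin 3} {d : Fin (2 * k + 1)} {w b z : ZMod (n - 2)} :
    pt j z ∈ block B₀ (Sum.inr (Sum.inr (Sum.inl (i, d, w, b))) : Index n k E₀ P) ↔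
      j = i + 2 ∧ z = -(base n k i d w + b) ∨
      j = i ∧ (z = w ∨ z = w + ((2 * d + 1 : ℕ) : ZMod (n - 2))) ∨ j = i + 1 ∧ z = b := by
  simp [block, and_or_left, or_assoc]

@[simp] theorem ptA_mem_block₃ {i : Fin 3} {d : Fin (2 * k + 1)} {w b : ZMod (n - 2)} {a : Fin 2} :
    ptA a ∉ block B₀ (Sum.inr (Sum.inr (Sum.inl (i, d, w, b))) : Index n k E₀ P) := by
  simp [block]

@[simp] theorem pt_mem_block₄ {i j : Fin 3} {q} {z : ZMod (n - 2)} :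
    pt j z ∈ block B₀ (Sum.inr (Sum.inr (Sum.inr (i, q))) : Index n k E₀ P) ↔
      j = i ∧ z ∈ q.1.2.1 ∨ j = i + 1 ∧ z ∈ q.1.2.2 := by
  simp [block]
  grind

@[simp] theorem ptA_mem_block₄ {i : Fin 3} {q} {a : Fin 2} :
    ptA a ∉ block B₀ (Sum.inr (Sum.inr (Sum.inr (i, q))) : Index n k E₀ P) := by
  simp [block]

theorem natCast_inj {a b : ℕ} (ha : a < n - 2) (hb : b < n - 2)
    (h : (a : ZMod (n - 2)) = b) : a = b := by
  rwa [ZMod.natCast_eq_natCast_iff', Nat.mod_eq_of_lt ha, Nat.mod_eq_of_lt hb] at h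

/-- Two points whose difference is small determine the difference and their order. -/
theorem eq_of_pair_eq (hn : n = 12 * k + 10) {d d' : ℕ} (hd : d < 2 * k + 1) (hd' : d' < 2 * k + 1)
    {w w' x y : ZMod (n - 2)} (hxy : x ≠ y)
    (hx : x = w ∨ x = w + ((2 * d + 1 : ℕ) : ZMod (n - 2)))
    (hy : y = w ∨ y = w + ((2 * d + 1 : ℕ) : ZMod (n - 2)))
    (hx' : x = w' ∨ x = w' + ((2 * d' + 1 : ℕ) : ZMod (n - 2)))
    (hy' : y = w' ∨ y = w' + ((2 * d' + 1 : ℕ) : ZMod (n - 2))) : d = d' ∧ w = w' := by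
  have h1 : ((2 * d + 1 : ℕ) : ZMod (n - 2)) = ((2 * d' + 1 : ℕ) : ZMod (n - 2)) → d = d' := by
    intro h
    have := natCast_inj (by omega) (by omega) h
    omega
  -- The sum of two such differences is at most `8k + 2 < 12k + 8`, so they are never opposite and a
  -- pair has only one orientation.
  have h2 : ((2 * d + 1 : ℕ) : ZMod (n - 2)) + ((2 * d' + 1 : ℕ) : ZMod (n - 2)) ≠ 0 := by
    intro h
    rw [← Nat.cast_add, ← Nat.cast_zero] at h
    have := natCast_inj (by omega) (by omega) h
    omega
  rcases hx with rfl | rfl <;> rcases hy with rfl | rfl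
  · exact absurd rfl hxy
  · rcases hx' with rfl | rfl
    · exact ⟨h1 (add_left_cancel (hy'.resolve_left hxy.symm)), rfl⟩
    · rcases hy' with h | h
      · exact absurd (by linear_combination h) h2
      · exact absurd h.symm hxy
  · rcases hx' with h | h
    · rcases hy' with rfl | h'
      · exact absurd h hxy
      · exact absurd (by linear_combination h - h') h2
    · rcases hy' with rfl | h'
      · exact ⟨h1 (by simpa using h), rfl⟩
      · exact absurd (h.trans h'.symm) hxy
  · exact absurd rfl hxy

/-- A pair with small odd difference does not lie in one of the later pair systems. -/
theorem not_mem_of_pair (hP : IsPairSystem (n - 2) (4 * k + 2) P) (hn : n = 12 * k + 10) {d α : ℕ}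
    (hd : d < 2 * k + 1) {w x y : ZMod (n - 2)} (hxy : x ≠ y)
    (hx : x = w ∨ x = w + ((2 * d + 1 : ℕ) : ZMod (n - 2)))
    (hy : y = w ∨ y = w + ((2 * d + 1 : ℕ) : ZMod (n - 2)))
    (hα : 4 * k + 2 ≤ α ∧ α ≤ 12 * k + 6) : s(x, y) ∉ P α := by
  intro h
  have := (hP.low α (by omega) x y h).2 ⟨d, by omega, by
    rcases hx with rfl | rfl <;> rcases hy with rfl | rfl
    · exact absurd rfl hxy
    · exact Or.inl rfl
    · exact Or.inr rfl
    · exact absurd rfl hxy⟩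
  omega

theorem exists_pair (hP : IsPairSystem (n - 2) (4 * k + 2) P) (hn : n = 12 * k + 10)
    {x y : ZMod (n - 2)} (hxy : x ≠ y) :
    (∃ (d : Fin (2 * k + 1)) (w : ZMod (n - 2)),
      (x = w ∨ x = w + ((2 * d + 1 : ℕ) : ZMod (n - 2))) ∧
      (y = w ∨ y = w + ((2 * d + 1 : ℕ) : ZMod (n - 2)))) ∨
    ∃ α, (4 * k + 2 ≤ α ∧ α ≤ 12 * k + 6) ∧ s(x, y) ∈ P α := by
  obtain ⟨α, ⟨hα, hxyα⟩, -⟩ := hP.factorization x y hxy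
  by_cases hα' : α < 4 * k + 2
  · obtain ⟨d, hd, h⟩ := (hP.low α hα x y hxyα).1 hα'
    left
    rcases h with h | h
    · exact ⟨⟨d, by omega⟩, x, Or.inl rfl, Or.inr h⟩
    · exact ⟨⟨d, by omega⟩, y, Or.inr h, Or.inl rfl⟩
  · exact Or.inr ⟨α, by omega, hxyα⟩

theorem eq_of_mem_of_mem (hP : IsPairSystem (n - 2) (4 * k + 2) P) {α : ℕ} (hα : α < n - 2 - 1)
    {p p' : Sym2 (ZMod (n - 2))} (hp : p ∈ P α) (hp' : p' ∈ P α) {z : ZMod (n - 2)}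
    (hz : z ∈ p) (hz' : z ∈ p') : p = p' := by
  obtain ⟨y, rfl⟩ := Sym2.mem_iff_exists.1 hz
  obtain ⟨y', rfl⟩ := Sym2.mem_iff_exists.1 hz'
  rw [(hP.matching α hα z).unique hp hp']

theorem layer_ne (i : Fin 3) : i + 1 ≠ i ∧ i + 2 ≠ i ∧ i + 1 ≠ i + 2 ∧ i + 1 + 1 = i + 2 ∧
    i + 1 + 2 = i ∧ i + 2 + 1 = i ∧ i + 2 + 2 = i + 1 := by
  revert i; decide

theorem pair_of_mem_block₃ {i i' : Fin 3} {d : Fin (2 * k + 1)} {w b x y : ZMod (n - 2)}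
    (hxy : x ≠ y)
    (hx : pt i x ∈ block B₀ (Sum.inr (Sum.inr (Sum.inl (i', d, w, b))) : Index n k E₀ P))
    (hy : pt i y ∈ block B₀ (Sum.inr (Sum.inr (Sum.inl (i', d, w, b))) : Index n k E₀ P)) :
    i = i' ∧ (x = w ∨ x = w + ((2 * d + 1 : ℕ) : ZMod (n - 2))) ∧
      (y = w ∨ y = w + ((2 * d + 1 : ℕ) : ZMod (n - 2))) := by
  have hi := layer_ne i'
  rw [pt_mem_block₃] at hx hy
  generalize w + ((2 * d + 1 : ℕ) : ZMod (n - 2)) = v at *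
  generalize -(base n k i' d w + b) = c at *
  rcases hx with ⟨h1, h2⟩ | ⟨h1, h2⟩ | ⟨h1, h2⟩ <;> rcases hy with ⟨h3, h4⟩ | ⟨h3, h4⟩ | ⟨h3, h4⟩
  · exact absurd (h2.trans h4.symm) hxy
  · exact absurd (h1.symm.trans h3) hi.2.1
  · exact absurd (h3.symm.trans h1) hi.2.2.1
  · exact absurd (h3.symm.trans h1) hi.2.1
  · exact ⟨h1, h2, h4⟩
  · exact absurd (h3.symm.trans h1) hi.1
  · exact absurd (h1.symm.trans h3) hi.2.2.1
  · exact absurd (h1.symm.trans h3) hi.1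
  · exact absurd (h2.trans h4.symm) hxy

theorem pair_of_mem_block₄ {i i' : Fin 3} {q} {x y : ZMod (n - 2)} (hxy : x ≠ y)
    (hx : pt i x ∈ block B₀ (Sum.inr (Sum.inr (Sum.inr (i', q))) : Index n k E₀ P))
    (hy : pt i y ∈ block B₀ (Sum.inr (Sum.inr (Sum.inr (i', q))) : Index n k E₀ P)) :
    i = i' ∧ q.1.2.1 = s(x, y) ∨ i = i' + 1 ∧ q.1.2.2 = s(x, y) := by
  have hi := layer_ne i'
  rw [pt_mem_block₄] at hx hy
  rcases hx with ⟨h1, h2⟩ | ⟨h1, h2⟩ <;> rcases hy with ⟨h3, h4⟩ | ⟨h3, h4⟩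
  · exact Or.inl ⟨h1, (Sym2.mem_and_mem_iff hxy).1 ⟨h2, h4⟩⟩
  · exact absurd (h3.symm.trans h1) hi.1
  · exact absurd (h1.symm.trans h3) hi.1
  · exact Or.inr ⟨h1, (Sym2.mem_and_mem_iff hxy).1 ⟨h2, h4⟩⟩

theorem not_mem_block₂ {i : Fin 3} {a : Fin 2} {u v x y : ZMod (n - 2)} (hxy : x ≠ y)
    (hx : pt i x ∈ block B₀ (Sum.inr (Sum.inl (a, u, v)) : Index n k E₀ P)) :
    pt i y ∉ block B₀ (Sum.inr (Sum.inl (a, u, v)) : Index n k E₀ P) := by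
  rw [pt_mem_block₂] at *
  generalize -((a.val : ZMod (n - 2)) + u + v) = w at *
  grind

/-- The three points lie in exactly one of the indexed blocks. -/
def InUniqueBlock (P : ℕ → Set (Sym2 (ZMod (n - 2)))) (k : ℕ) (B₀ : E₀ → Finset (OldPoint n))
    (x y z : NewPoint n) : Prop :=
  ∃! e : Index n k E₀ P, x ∈ block B₀ e ∧ y ∈ block B₀ e ∧ z ∈ block B₀ e

end HananiFourth

/-! ### Triples with two points in a layer or with a point `A` -/

namespace HananiFourth

variable {n k : ℕ} {E₀ : Type*} {P : ℕ → Set (Sym2 (ZMod (n - 2)))}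
  {B₀ : E₀ → Finset (OldPoint n)}

theorem InUniqueBlock.swap_left {x y z : NewPoint n} (h : InUniqueBlock P k B₀ x y z) :
    InUniqueBlock P k B₀ y x z := by
  unfold InUniqueBlock at *
  simpa only [and_left_comm] using h

theorem InUniqueBlock.swap_right {x y z : NewPoint n} (h : InUniqueBlock P k B₀ x y z) :
    InUniqueBlock P k B₀ x z y := by
  unfold InUniqueBlock at *
  simpa only [and_comm (a := z ∈ _)] using h

variable (hB₀ : ∀ x y z, x ≠ y → x ≠ z → y ≠ z → ∃! e, x ∈ B₀ e ∧ y ∈ B₀ e ∧ z ∈ B₀ e)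

include hB₀ in
theorem inUniqueBlock_ptA_ptA_pt {a b : Fin 2} (hab : a ≠ b) (i : Fin 3) (x : ZMod (n - 2)) :
    InUniqueBlock P k B₀ (ptA a) (ptA b) (pt i x) := by
  obtain ⟨e, he, hu⟩ := hB₀ (Sum.inr a) (Sum.inr b) (Sum.inl x) (by simpa) (by simp) (by simp)
  refine ⟨Sum.inl (i, e), by simpa using he, ?_⟩
  rintro (⟨i', e'⟩ | ⟨a', u, v⟩ | ⟨i', d, w, c⟩ | ⟨i', q⟩) ⟨h1, h2, h3⟩
  · simp only [ptA_mem_block₁, pt_mem_block₁] at h1 h2 h3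
    rw [hu e' ⟨h1, h2, h3.2⟩, h3.1]
  · simp only [ptA_mem_block₂] at h1 h2
    exact absurd (h1.trans h2.symm) hab
  · simp at h1
  · simp at h1

include hB₀ in
theorem inUniqueBlock_ptA_pt_pt {a : Fin 2} (i : Fin 3) {x y : ZMod (n - 2)} (hxy : x ≠ y) :
    InUniqueBlock P k B₀ (ptA a) (pt i x) (pt i y) := by
  obtain ⟨e, he, hu⟩ := hB₀ (Sum.inr a) (Sum.inl x) (Sum.inl y) (by simp) (by simp) (by simpa)
  refine ⟨Sum.inl (i, e), by simpa using he, ?_⟩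
  rintro (⟨i', e'⟩ | ⟨a', u, v⟩ | ⟨i', d, w, c⟩ | ⟨i', q⟩) ⟨h1, h2, h3⟩
  · simp only [ptA_mem_block₁, pt_mem_block₁] at h1 h2 h3
    rw [hu e' ⟨h1, h2.2, h3.2⟩, h3.1]
  · exact absurd h3 (not_mem_block₂ B₀ ‹_› h2)
  · simp at h1
  · simp at h1

-- Blocks of types 2, 3 and 4 have at most two points in any layer, so only the copy of the old
-- system remains.
include hB₀ in
theorem inUniqueBlock_same (i : Fin 3) {x y z : ZMod (n - 2)} (hxy : x ≠ y) (hxz : x ≠ z)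
    (hyz : y ≠ z) : InUniqueBlock P k B₀ (pt i x) (pt i y) (pt i z) := by
  obtain ⟨e, he, hu⟩ := hB₀ (Sum.inl x) (Sum.inl y) (Sum.inl z) (by simpa) (by simpa) (by simpa)
  refine ⟨Sum.inl (i, e), by simpa using he, ?_⟩
  rintro (⟨i', e'⟩ | ⟨a', u, v⟩ | ⟨i', d, w, c⟩ | ⟨i', q⟩) ⟨h1, h2, h3⟩
  · simp only [pt_mem_block₁] at h1 h2 h3
    rw [hu e' ⟨h1.2, h2.2, h3.2⟩, h3.1]
  · exact absurd h3 (not_mem_block₂ B₀ ‹_› h2)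
  · obtain ⟨-, hx, hy⟩ := pair_of_mem_block₃ B₀ hxy h1 h2
    obtain ⟨-, -, hz⟩ := pair_of_mem_block₃ B₀ hxz h1 h3
    grind
  · have hxy' := pair_of_mem_block₄ B₀ hxy h1 h2
    have hxz' := pair_of_mem_block₄ B₀ hxz h1 h3
    have hi := layer_ne i'
    have key : s(x, y) ≠ s(x, z) := fun h => hyz (Sym2.congr_right.1 h)
    grind

/-- Only type 2 joins an `A` to two layers; its linear equation then determines the fourth point.
The next two lemmas solve it for other coordinates. -/
theorem inUniqueBlock_ptA_zero_one (a : Fin 2) (x y : ZMod (n - 2)) :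
    InUniqueBlock P k B₀ (ptA a) (pt 0 x) (pt 1 y) := by
  refine ⟨Sum.inr (Sum.inl (a, x, y)), by simp, ?_⟩
  rintro (⟨i', e'⟩ | ⟨a', u, v⟩ | ⟨i', d, w, c⟩ | ⟨i', q⟩) ⟨h1, h2, h3⟩
  · simp only [pt_mem_block₁] at h2 h3
    exact absurd (h2.1.trans h3.1.symm) (by decide)
  · simp at h1 h2 h3
    subst h1 h2 h3
    simp
  · simp at h1
  · simp at h1

theorem inUniqueBlock_ptA_zero_two (a : Fin 2) (x y : ZMod (n - 2)) :
    InUniqueBlock P k B₀ (ptA a) (pt 0 x) (pt 2 y) := by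
  refine ⟨Sum.inr (Sum.inl (a, x, -(a.val + x + y))), by simp; ring, ?_⟩
  rintro (⟨i', e'⟩ | ⟨a', u, v⟩ | ⟨i', d, w, c⟩ | ⟨i', q⟩) ⟨h1, h2, h3⟩
  · simp only [pt_mem_block₁] at h2 h3
    exact absurd (h2.1.trans h3.1.symm) (by decide)
  · simp at h1 h2 h3
    subst h1 h2 h3
    simp
    ring
  · simp at h1
  · simp at h1

theorem inUniqueBlock_ptA_one_two (a : Fin 2) (x y : ZMod (n - 2)) :
    InUniqueBlock P k B₀ (ptA a) (pt 1 x) (pt 2 y) := by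
  refine ⟨Sum.inr (Sum.inl (a, -(a.val + x + y), x)), by simp; ring, ?_⟩
  rintro (⟨i', e'⟩ | ⟨a', u, v⟩ | ⟨i', d, w, c⟩ | ⟨i', q⟩) ⟨h1, h2, h3⟩
  · simp only [pt_mem_block₁] at h2 h3
    exact absurd (h2.1.trans h3.1.symm) (by decide)
  · simp at h1 h2 h3
    simp only [Sum.inr.injEq, Sum.inl.injEq, Prod.mk.injEq]
    refine ⟨h1.symm, ?_, h2.symm⟩
    subst h1 h2
    linear_combination h3
  · simp at h1
  · simp at h1

/-- The pair `{x, y}` decides the type. A small odd difference fixes `i`, `d`, `w` in type 3 and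
leaves the point in layer `i + 1` free; otherwise it fixes `α`, and the second pair is the one of `P
α` through `z`. -/
theorem inUniqueBlock_pair_succ (hP : IsPairSystem (n - 2) (4 * k + 2) P) (hn : n = 12 * k + 10)
    (i : Fin 3) {x y : ZMod (n - 2)} (hxy : x ≠ y) (z : ZMod (n - 2)) :
    InUniqueBlock P k B₀ (pt i x) (pt i y) (pt (i + 1) z) := by
  have hi := layer_ne i
  rcases exists_pair hP hn hxy with ⟨d, w, hx, hy⟩ | ⟨α, hα, hxyα⟩
  · refine ⟨Sum.inr (Sum.inr (Sum.inl (i, d, w, z))), ⟨?_, ?_, ?_⟩, ?_⟩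
    · exact (pt_mem_block₃ B₀).2 (Or.inr (Or.inl ⟨rfl, hx⟩))
    · exact (pt_mem_block₃ B₀).2 (Or.inr (Or.inl ⟨rfl, hy⟩))
    · exact (pt_mem_block₃ B₀).2 (Or.inr (Or.inr ⟨rfl, rfl⟩))
    rintro (⟨i', e'⟩ | ⟨a', u, v⟩ | ⟨i', d', w', c⟩ | ⟨i', ⟨⟨α, p, p'⟩, hα, hp, hp'⟩⟩) ⟨h1, h2, h3⟩
    · simp only [pt_mem_block₁] at h2 h3
      exact absurd (h3.1.trans h2.1.symm) hi.1
    · exact absurd h2 (not_mem_block₂ B₀ hxy h1)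
    · obtain ⟨rfl, hx', hy'⟩ := pair_of_mem_block₃ B₀ hxy h1 h2
      obtain ⟨h4, rfl⟩ := eq_of_pair_eq hn d.2 d'.2 hxy hx hy hx' hy'
      obtain rfl := Fin.ext h4
      have h5 : z = c := by
        rw [pt_mem_block₃] at h3
        exact ((h3.resolve_left fun h => hi.2.2.1 h.1).resolve_left fun h => hi.1 h.1).2
      rw [h5]
    · have hno := not_mem_of_pair hP hn d.2 hxy hx hy hα
      rcases pair_of_mem_block₄ B₀ hxy h1 h2 with ⟨-, rfl⟩ | ⟨-, rfl⟩
      · exact absurd hp hno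
      · exact absurd hp' hno
  · obtain ⟨z', hz', -⟩ := hP.matching α (by omega) z
    refine ⟨Sum.inr (Sum.inr (Sum.inr (i, ⟨(α, s(x, y), s(z, z')), hα, hxyα, hz'⟩))), by simp, ?_⟩
    rintro (⟨i', e'⟩ | ⟨a', u, v⟩ | ⟨i', d', w', c⟩ | ⟨i', ⟨⟨α', p, p'⟩, hα', hp, hp'⟩⟩)
      ⟨h1, h2, h3⟩
    · simp only [pt_mem_block₁] at h2 h3
      exact absurd (h3.1.trans h2.1.symm) hi.1
    · exact absurd h2 (not_mem_block₂ B₀ hxy h1)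
    · obtain ⟨-, hx', hy'⟩ := pair_of_mem_block₃ B₀ hxy h1 h2
      exact absurd hxyα (not_mem_of_pair hP hn d'.2 hxy hx' hy' hα)
    · have hi' := layer_ne i'
      rw [pt_mem_block₄] at h3
      rcases pair_of_mem_block₄ B₀ hxy h1 h2 with ⟨rfl, h⟩ | ⟨rfl, h⟩ <;> dsimp only at h <;>
        subst h
      · obtain rfl := (hP.factorization x y hxy).unique ⟨by omega, hp⟩ ⟨by omega, hxyα⟩
        obtain rfl := eq_of_mem_of_mem hP (by omega) hp' hz' (h3.resolve_left fun h => hi.1 h.1).2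
          (Sym2.mem_mk_left _ _)
        rfl
      · rw [hi'.2.2.2.1] at h3
        exact (h3.elim (fun h => hi'.2.1 h.1) fun h => hi'.2.2.1 h.1.symm).elim

/-- Same dichotomy, but in type 3 the zero-sum condition now yields the point in layer `i + 1` from
`z`, and in type 4 the block is indexed by layer `i + 2`, with `{x, y}` as its second pair. -/
theorem inUniqueBlock_pair_pred (hP : IsPairSystem (n - 2) (4 * k + 2) P) (hn : n = 12 * k + 10)
    (i : Fin 3) {x y : ZMod (n - 2)} (hxy : x ≠ y) (z : ZMod (n - 2)) :
    InUniqueBlock P k B₀ (pt i x) (pt i y) (pt (i + 2) z) := by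
  have hi := layer_ne i
  rcases exists_pair hP hn hxy with ⟨d, w, hx, hy⟩ | ⟨α, hα, hxyα⟩
  · refine ⟨Sum.inr (Sum.inr (Sum.inl (i, d, w, -(base n k i d w + z)))), ⟨?_, ?_, ?_⟩, ?_⟩
    · exact (pt_mem_block₃ B₀).2 (Or.inr (Or.inl ⟨rfl, hx⟩))
    · exact (pt_mem_block₃ B₀).2 (Or.inr (Or.inl ⟨rfl, hy⟩))
    · exact (pt_mem_block₃ B₀).2 (Or.inl ⟨rfl, by ring⟩)
    rintro (⟨i', e'⟩ | ⟨a', u, v⟩ | ⟨i', d', w', c⟩ | ⟨i', ⟨⟨α, p, p'⟩, hα, hp, hp'⟩⟩) ⟨h1, h2, h3⟩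
    · simp only [pt_mem_block₁] at h2 h3
      exact absurd (h3.1.trans h2.1.symm) hi.2.1
    · exact absurd h2 (not_mem_block₂ B₀ hxy h1)
    · obtain ⟨rfl, hx', hy'⟩ := pair_of_mem_block₃ B₀ hxy h1 h2
      obtain ⟨h4, rfl⟩ := eq_of_pair_eq hn d.2 d'.2 hxy hx hy hx' hy'
      obtain rfl := Fin.ext h4
      have h5 : z = -(base n k i d w + c) := by
        rw [pt_mem_block₃] at h3
        exact (h3.resolve_right fun h => h.elim (fun h => hi.2.1 h.1)
          fun h => hi.2.2.1 h.1.symm).2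
      subst h5
      simp
    · have hno := not_mem_of_pair hP hn d.2 hxy hx hy hα
      rcases pair_of_mem_block₄ B₀ hxy h1 h2 with ⟨-, rfl⟩ | ⟨-, rfl⟩
      · exact absurd hp hno
      · exact absurd hp' hno
  · obtain ⟨z', hz', -⟩ := hP.matching α (by omega) z
    refine ⟨Sum.inr (Sum.inr (Sum.inr (i + 2, ⟨(α, s(z, z'), s(x, y)), hα, hz', hxyα⟩))),
      by simp [hi.2.2.2.2.2.1], ?_⟩
    rintro (⟨i', e'⟩ | ⟨a', u, v⟩ | ⟨i', d', w', c⟩ | ⟨i', ⟨⟨α', p, p'⟩, hα', hp, hp'⟩⟩)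
      ⟨h1, h2, h3⟩
    · simp only [pt_mem_block₁] at h2 h3
      exact absurd (h3.1.trans h2.1.symm) hi.2.1
    · exact absurd h2 (not_mem_block₂ B₀ hxy h1)
    · obtain ⟨-, hx', hy'⟩ := pair_of_mem_block₃ B₀ hxy h1 h2
      exact absurd hxyα (not_mem_of_pair hP hn d'.2 hxy hx' hy' hα)
    · have hi' := layer_ne i'
      rw [pt_mem_block₄] at h3
      rcases pair_of_mem_block₄ B₀ hxy h1 h2 with ⟨rfl, h⟩ | ⟨rfl, h⟩ <;> dsimp only at h <;>
        subst h
      · exact (h3.elim (fun h => hi'.2.1 h.1) fun h => hi'.2.2.1 h.1.symm).elim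
      · obtain rfl := (hP.factorization x y hxy).unique ⟨by omega, hp'⟩ ⟨by omega, hxyα⟩
        obtain rfl := eq_of_mem_of_mem hP (by omega) hp hz' (h3.resolve_right fun h => hi.2.1 h.1).2
          (Sym2.mem_mk_left _ _)
        simp [add_assoc]

end HananiFourth

/-- If the blocks of a Steiner quadruple system are indexed without repetition, any three distinct
points lie in the block of exactly one index. -/
theorem IsSQS.existsUnique_index {Y E : Type*} {v : ℕ} {C : Set (Finset Y)} (hC : IsSQS v C)
    {blk : E → Finset Y} (h : Set.BijOn blk Set.univ C) (x y z : Y) (hxy : x ≠ y) (hxz : x ≠ z)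
    (hyz : y ≠ z) : ∃! e, x ∈ blk e ∧ y ∈ blk e ∧ z ∈ blk e := by
  classical
  obtain ⟨b, ⟨hb, hs⟩, hu⟩ := hC.existsUnique_block {x, y, z}
    (Finset.card_eq_three.2 ⟨x, y, z, hxy, hxz, hyz, rfl⟩)
  obtain ⟨e, -, rfl⟩ := h.surjOn hb
  refine ⟨e, by simpa [Finset.insert_subset_iff] using hs, fun e' he' => ?_⟩
  refine h.injOn (Set.mem_univ _) (Set.mem_univ _) (hu _ ⟨h.mapsTo (Set.mem_univ _), ?_⟩)
  simpa [Finset.insert_subset_iff] using he'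

theorem BlockTour.finite {Y E : Type*} [Finite Y] {C : Set (Finset Y)} (t : BlockTour C E) :
    Finite E :=
  Finite.of_injective t.blk fun _ _ h => t.bijOn.injOn (Set.mem_univ _) (Set.mem_univ _) h

/-! ### Transversal triples, sorted by their sum -/

namespace HananiFourth

variable {n k : ℕ} {E₀ : Type*} {P : ℕ → Set (Sym2 (ZMod (n - 2)))}
  {B₀ : E₀ → Finset (OldPoint n)}

/-- For fixed `i` the offsets descend and ascend from the middle of the interval from `i(4k+2) + 1`
to `(i+1)(4k+2)`, so they fill it without repetition, and the three intervals are disjoint. -/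
theorem offset_unique {i i' d d' : ℕ} (hi : i < 3) (hi' : i' < 3) (hd : d < 2 * k + 1)
    (hd' : d' < 2 * k + 1) :
    (2 * k + 1 + i * (4 * k + 2) - d = 2 * k + 1 + i' * (4 * k + 2) - d' → i = i' ∧ d = d') ∧
    (2 * k + 1 + i * (4 * k + 2) + d + 1 = 2 * k + 1 + i' * (4 * k + 2) + d' + 1 →
      i = i' ∧ d = d') ∧
    2 * k + 1 + i * (4 * k + 2) - d ≠ 2 * k + 1 + i' * (4 * k + 2) + d' + 1 := by
  interval_cases i <;> interval_cases i' <;> omega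

theorem offset_bounds {i d : ℕ} (hi : i < 3) (hd : d < 2 * k + 1) :
    (0 < 2 * k + 1 + i * (4 * k + 2) - d ∧ 2 * k + 1 + i * (4 * k + 2) - d < 12 * k + 7) ∧
    (0 < 2 * k + 1 + i * (4 * k + 2) + d + 1 ∧
      2 * k + 1 + i * (4 * k + 2) + d + 1 < 12 * k + 7) ∧
    d ≤ 2 * k + 1 + i * (4 * k + 2) := by
  interval_cases i <;> omega

theorem exists_offset {t : ℕ} (h0 : 0 < t) (ht : t < 12 * k + 7) :
    ∃ (i : Fin 3) (d : Fin (2 * k + 1)), t = 2 * k + 1 + i.val * (4 * k + 2) - d ∨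
      t = 2 * k + 1 + i.val * (4 * k + 2) + d + 1 := by
  obtain ⟨i, hi, hi'⟩ : ∃ i : Fin 3, i.val * (4 * k + 2) < t ∧
      t ≤ i.val * (4 * k + 2) + (4 * k + 2) := by
    by_cases h1 : t ≤ 4 * k + 2
    · exact ⟨0, by simpa, by simpa⟩
    · by_cases h2 : t ≤ 8 * k + 4
      · exact ⟨1, by simp; omega, by simp; omega⟩
      · exact ⟨2, by simp; omega, by simp; omega⟩
  by_cases h : t ≤ 2 * k + 1 + i.val * (4 * k + 2)
  · exact ⟨i, ⟨2 * k + 1 + i.val * (4 * k + 2) - t, by omega⟩, Or.inl (by simp; omega)⟩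
  · exact ⟨i, ⟨t - 1 - (2 * k + 1 + i.val * (4 * k + 2)), by omega⟩, Or.inr (by simp; omega)⟩

/-- As `b₁ + b₂ + b₃ = 0`, the sum of such a triple is its point in layer `i` minus `b₁`, which
depends only on `i`, `d` and which of the two points is taken. -/
theorem transversal_mem_block₃ (p : Fin 3 → ZMod (n - 2)) (i : Fin 3)
    (d : Fin (2 * k + 1)) (w b : ZMod (n - 2)) :
    (∀ j, pt j (p j) ∈ block B₀ (Sum.inr (Sum.inr (Sum.inl (i, d, w, b))) : Index n k E₀ P)) ↔
      b = p (i + 1) ∧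
      (p i = w ∧ p 0 + p 1 + p 2 = ((2 * k + 1 + i.val * (4 * k + 2) - d : ℕ) : ZMod (n - 2)) ∨
        p i = w + ((2 * d + 1 : ℕ) : ZMod (n - 2)) ∧
        p 0 + p 1 + p 2 = ((2 * k + 1 + i.val * (4 * k + 2) + d + 1 : ℕ) : ZMod (n - 2))) := by
  have hsum : p 0 + p 1 + p 2 = p i + p (i + 1) + p (i + 2) := by
    fin_cases i
    · rfl
    · change p 0 + p 1 + p 2 = p 1 + p 2 + p 0
      ring
    · change p 0 + p 1 + p 2 = p 2 + p 0 + p 1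
      ring
  have hall : ∀ Q : Fin 3 → Prop, (∀ j, Q j) ↔ Q i ∧ Q (i + 1) ∧ Q (i + 2) := by
    intro Q
    refine ⟨fun h => ⟨h _, h _, h _⟩, fun h j => ?_⟩
    have : j = i ∨ j = i + 1 ∨ j = i + 2 := by
      clear hsum h Q
      revert i j
      decide
    rcases this with rfl | rfl | rfl
    exacts [h.1, h.2.1, h.2.2]
  have hi := layer_ne i
  rw [hall, hsum, pt_mem_block₃, pt_mem_block₃, pt_mem_block₃,
    Nat.cast_sub (offset_bounds i.2 d.2).2.2]
  simp only [hi.1, hi.2.1, hi.2.2.1, hi.1.symm, hi.2.1.symm, hi.2.2.1.symm, false_and, true_and,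
    false_or, or_false, base]
  generalize p i = x
  generalize p (i + 1) = y
  generalize p (i + 2) = z
  push_cast
  constructor
  · rintro ⟨rfl | rfl, rfl, rfl⟩
    · exact ⟨rfl, Or.inl ⟨rfl, by ring⟩⟩
    · exact ⟨rfl, Or.inr ⟨rfl, by ring⟩⟩
  · rintro ⟨rfl, ⟨rfl, h⟩ | ⟨rfl, h⟩⟩
    · exact ⟨Or.inl rfl, rfl, by linear_combination h⟩
    · exact ⟨Or.inr rfl, rfl, by linear_combination h⟩

/-- The sum modulo `12k + 8` selects the type: `0` and `12k + 7` belong to type 2, the values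
between to exactly one offset of type 3. The points then fix the remaining parameters. -/
theorem inUniqueBlock_transversal (hn : n = 12 * k + 10) (p : Fin 3 → ZMod (n - 2)) :
    InUniqueBlock P k B₀ (pt 0 (p 0)) (pt 1 (p 1)) (pt 2 (p 2)) := by
  have : NeZero (n - 2) := ⟨by omega⟩
  have hall : ∀ Q : Fin 3 → Prop, Q 0 ∧ Q 1 ∧ Q 2 ↔ ∀ j, Q j := by
    intro Q
    simp [Fin.forall_fin_succ]
  unfold InUniqueBlock
  simp only [fun e : Index n k E₀ P => hall fun j => pt j (p j) ∈ block B₀ e]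
  have h₁ : ∀ i e, ¬ ∀ j, pt j (p j) ∈ block B₀ (Sum.inl (i, e) : Index n k E₀ P) := by
    intro i e h
    have h0 := (pt_mem_block₁ B₀).1 (h 0)
    have h1 := (pt_mem_block₁ B₀).1 (h 1)
    exact absurd (h0.1.trans h1.1.symm) (by decide)
  have h₂ : ∀ a u v, (∀ j, pt j (p j) ∈ block B₀ (Sum.inr (Sum.inl (a, u, v)) : Index n k E₀ P)) ↔
      p 0 = u ∧ p 1 = v ∧ p 0 + p 1 + p 2 + (a.val : ZMod (n - 2)) = 0 := by
    intro a u v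
    rw [← hall, pt_mem_block₂, pt_mem_block₂, pt_mem_block₂]
    simp only [show (0 : Fin 3) ≠ 1 by decide, show (0 : Fin 3) ≠ 2 by decide,
      show (1 : Fin 3) ≠ 0 by decide, show (1 : Fin 3) ≠ 2 by decide,
      show (2 : Fin 3) ≠ 0 by decide, show (2 : Fin 3) ≠ 1 by decide, true_and, false_and,
      false_or, or_false]
    constructor
    · rintro ⟨rfl, rfl, h⟩
      exact ⟨rfl, rfl, by rw [h]; ring⟩
    · rintro ⟨rfl, rfl, h⟩
      exact ⟨rfl, rfl, by linear_combination h⟩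
  have h₄ : ∀ i q, ¬ ∀ j, pt j (p j) ∈
      block B₀ (Sum.inr (Sum.inr (Sum.inr (i, q))) : Index n k E₀ P) := by
    intro i q h
    have hi := layer_ne i
    rcases (pt_mem_block₄ B₀).1 (h (i + 2)) with h | h
    · exact hi.2.1 h.1
    · exact hi.2.2.1 h.1.symm
  obtain ⟨t, ht, hS⟩ : ∃ t < n - 2, p 0 + p 1 + p 2 = (t : ZMod (n - 2)) :=
    ⟨_, ZMod.val_lt _, (ZMod.natCast_zmod_val _).symm⟩
  -- The sum must be `-a`, so its representative is `0` or `12k + 7`.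
  have hA : ∀ a : Fin 2, p 0 + p 1 + p 2 + (a.val : ZMod (n - 2)) = 0 ↔
      a = 0 ∧ t = 0 ∨ a = 1 ∧ t = 12 * k + 7 := by
    intro a
    rw [hS, ← Nat.cast_add, ZMod.natCast_eq_zero_iff]
    have hM : n - 2 = 12 * k + 8 := by omega
    rw [hM] at ht ⊢
    constructor
    · rintro ⟨c, hc⟩
      have hc2 : c < 2 := by
        by_contra hcon
        have := Nat.mul_le_mul_left (12 * k + 8) (show 2 ≤ c by omega)
        omega
      interval_cases c <;> omega
    · rintro (⟨rfl, rfl⟩ | ⟨rfl, rfl⟩)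
      · simp
      · simp
  have hinj : ∀ {s : ℕ}, s < 12 * k + 7 → p 0 + p 1 + p 2 = (s : ZMod (n - 2)) → t = s :=
    fun hs h => natCast_inj ht (by omega) (hS.symm.trans h)
  have h₃ := transversal_mem_block₃ (B₀ := B₀) (P := P) (k := k) p
  by_cases h0 : t = 0 ∨ t = 12 * k + 7
  · obtain ⟨a, ha, hua⟩ : ∃ a : Fin 2, (a = 0 ∧ t = 0 ∨ a = 1 ∧ t = 12 * k + 7) ∧
        ∀ a' : Fin 2, (a' = 0 ∧ t = 0 ∨ a' = 1 ∧ t = 12 * k + 7) → a' = a := by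
      rcases h0 with h0 | h0
      · exact ⟨0, Or.inl ⟨rfl, h0⟩, fun a' h => h.elim (fun h => h.1) fun h => by omega⟩
      · exact ⟨1, Or.inr ⟨rfl, h0⟩, fun a' h => h.elim (fun h => by omega) fun h => h.1⟩
    refine ⟨Sum.inr (Sum.inl (a, p 0, p 1)), (h₂ _ _ _).2 ⟨rfl, rfl, (hA a).2 ha⟩, ?_⟩
    rintro (⟨i', e'⟩ | ⟨a', u, v⟩ | ⟨i', d', w', c⟩ | ⟨i', q⟩) hmem
    · exact absurd hmem (h₁ _ _)
    · obtain ⟨rfl, rfl, h⟩ := (h₂ _ _ _).1 hmem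
      rw [hua a' ((hA a').1 h)]
    · have hb := offset_bounds i'.2 d'.2
      obtain ⟨-, ⟨-, h⟩ | ⟨-, h⟩⟩ := (h₃ _ _ _ _).1 hmem
      · have := hinj hb.1.2 h
        omega
      · have := hinj hb.2.1.2 h
        omega
    · exact absurd hmem (h₄ _ _)
  · obtain ⟨i, d, hid⟩ := exists_offset (k := k) (t := t) (by omega) (by omega)
    have huniq : ∀ w w' : ZMod (n - 2), ∀ (i' : Fin 3) (d' : Fin (2 * k + 1)),
        (p i = w ∧ t = 2 * k + 1 + i.val * (4 * k + 2) - d ∨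
          p i = w + ((2 * d + 1 : ℕ) : ZMod (n - 2)) ∧
            t = 2 * k + 1 + i.val * (4 * k + 2) + d + 1) →
        (p i' = w' ∧ t = 2 * k + 1 + i'.val * (4 * k + 2) - d' ∨
          p i' = w' + ((2 * d' + 1 : ℕ) : ZMod (n - 2)) ∧
            t = 2 * k + 1 + i'.val * (4 * k + 2) + d' + 1) → i' = i ∧ d' = d ∧ w' = w := by
      intro w w' i' d' h h'
      have hu := offset_unique (k := k) i'.2 i.2 d'.2 d.2
      have hu' := offset_unique (k := k) i.2 i'.2 d.2 d'.2
      rcases h with ⟨h1, h2⟩ | ⟨h1, h2⟩ <;> rcases h' with ⟨h3, h4⟩ | ⟨h3, h4⟩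
      · obtain ⟨h5, h6⟩ := hu.1 (h4.symm.trans h2)
        obtain rfl := Fin.ext h5
        exact ⟨rfl, Fin.ext h6, h3.symm.trans h1⟩
      · exact absurd (h2.symm.trans h4) hu'.2.2
      · exact absurd (h4.symm.trans h2) hu.2.2
      · obtain ⟨h5, h6⟩ := hu.2.1 (h4.symm.trans h2)
        obtain rfl := Fin.ext h5
        obtain rfl := Fin.ext h6
        exact ⟨rfl, rfl, add_right_cancel (h3.symm.trans h1)⟩
    obtain ⟨w, hw⟩ : ∃ w, p i = w ∧ t = 2 * k + 1 + i.val * (4 * k + 2) - d ∨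
          p i = w + ((2 * d + 1 : ℕ) : ZMod (n - 2)) ∧
            t = 2 * k + 1 + i.val * (4 * k + 2) + d + 1 := by
      rcases hid with h | h
      · exact ⟨p i, Or.inl ⟨rfl, h⟩⟩
      · exact ⟨p i - ((2 * d + 1 : ℕ) : ZMod (n - 2)), Or.inr ⟨by ring, h⟩⟩
    refine ⟨Sum.inr (Sum.inr (Sum.inl (i, d, w, p (i + 1)))), ?_, ?_⟩
    · refine (h₃ _ _ _ _).2 ⟨rfl, ?_⟩
      rw [hS]
      rcases hw with ⟨h, h'⟩ | ⟨h, h'⟩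
      · exact Or.inl ⟨h, congrArg _ h'⟩
      · exact Or.inr ⟨h, congrArg _ h'⟩
    rintro (⟨i', e'⟩ | ⟨a', u, v⟩ | ⟨i', d', w', c⟩ | ⟨i', q⟩) hmem
    · exact absurd hmem (h₁ _ _)
    · obtain ⟨-, -, h⟩ := (h₂ _ _ _).1 hmem
      have := (hA a').1 h
      omega
    · have hb := offset_bounds i'.2 d'.2
      obtain ⟨rfl, h⟩ := (h₃ _ _ _ _).1 hmem
      obtain ⟨rfl, rfl, rfl⟩ := huniq w w' i' d' hw
        (h.imp (fun h => ⟨h.1, hinj hb.1.2 h.2⟩) fun h => ⟨h.1, hinj hb.2.1.2 h.2⟩)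
      rfl
    · exact absurd hmem (h₄ _ _)

theorem inUniqueBlock (hP : IsPairSystem (n - 2) (4 * k + 2) P) (hn : n = 12 * k + 10)
    (hB₀ : ∀ x y z, x ≠ y → x ≠ z → y ≠ z → ∃! e, x ∈ B₀ e ∧ y ∈ B₀ e ∧ z ∈ B₀ e)
    (x y z : NewPoint n) (hxy : x ≠ y) (hxz : x ≠ z) (hyz : y ≠ z) :
    InUniqueBlock P k B₀ x y z := by
  have hpair : ∀ (i j : Fin 3) (x y z : ZMod (n - 2)), i ≠ j → x ≠ y →
      InUniqueBlock P k B₀ (pt i x) (pt i y) (pt j z) := by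
    intro i j x y z hij hxy
    have : j = i + 1 ∨ j = i + 2 := by
      revert i j
      decide
    rcases this with rfl | rfl
    · exact inUniqueBlock_pair_succ hP hn i hxy z
    · exact inUniqueBlock_pair_pred hP hn i hxy z
  have hApp : ∀ (a : Fin 2) (i j : Fin 3) (x y : ZMod (n - 2)), (pt i x : NewPoint n) ≠ pt j y →
      InUniqueBlock P k B₀ (ptA a) (pt i x) (pt j y) := by
    intro a i j x y h
    by_cases hij : i = j
    · subst hij
      exact inUniqueBlock_ptA_pt_pt hB₀ i fun hxy => h (by rw [hxy])
    · fin_cases i <;> fin_cases j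
      · exact absurd rfl hij
      · exact inUniqueBlock_ptA_zero_one a x y
      · exact inUniqueBlock_ptA_zero_two a x y
      · exact (inUniqueBlock_ptA_zero_one a y x).swap_right
      · exact absurd rfl hij
      · exact inUniqueBlock_ptA_one_two a x y
      · exact (inUniqueBlock_ptA_zero_two a y x).swap_right
      · exact (inUniqueBlock_ptA_one_two a y x).swap_right
      · exact absurd rfl hij
  have hT : ∀ x y z : ZMod (n - 2), InUniqueBlock P k B₀ (pt 0 x) (pt 1 y) (pt 2 z) :=
    fun x y z => inUniqueBlock_transversal hn ![x, y, z]
  have hppp : ∀ (i j l : Fin 3) (x y z : ZMod (n - 2)), i ≠ j → i ≠ l → j ≠ l →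
      InUniqueBlock P k B₀ (pt i x) (pt j y) (pt l z) := by
    intro i j l x y z hij hil hjl
    fin_cases i <;> fin_cases j <;> fin_cases l <;>
      first
      | exact absurd rfl hij
      | exact absurd rfl hil
      | exact absurd rfl hjl
      | exact hT _ _ _
      | exact (hT _ _ _).swap_left
      | exact (hT _ _ _).swap_right
      | exact (hT _ _ _).swap_left.swap_right
      | exact (hT _ _ _).swap_right.swap_left
      | exact (hT _ _ _).swap_right.swap_left.swap_right
  rcases x with ⟨i, x⟩ | a <;> rcases y with ⟨j, y⟩ | b <;> rcases z with ⟨l, z⟩ | c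
  · by_cases hij : i = j
    · subst hij
      have hxy' : x ≠ y := fun h => hxy (by rw [h])
      by_cases hil : i = l
      · subst hil
        exact inUniqueBlock_same hB₀ i hxy' (fun h => hxz (by rw [h])) fun h => hyz (by rw [h])
      · exact hpair _ _ _ _ _ hil hxy'
    · by_cases hil : i = l
      · subst hil
        exact (hpair _ _ _ _ _ hij fun h => hxz (by rw [h])).swap_right
      · by_cases hjl : j = l
        · subst hjl
          exact (hpair _ _ _ _ _ (Ne.symm hij) fun h => hyz (by rw [h])).swap_right.swap_left
        · exact hppp _ _ _ _ _ _ hij hil hjl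
  · exact (hApp c _ _ _ _ hxy).swap_left.swap_right
  · exact (hApp b _ _ _ _ hxz).swap_left
  · exact (inUniqueBlock_ptA_ptA_pt hB₀ (fun h => hyz (by rw [h])) i x).swap_right.swap_left
  · exact hApp a _ _ _ _ hyz
  · exact (inUniqueBlock_ptA_ptA_pt hB₀ (fun h => hxz (by rw [h])) j y).swap_right
  · exact inUniqueBlock_ptA_ptA_pt hB₀ (fun h => hxy (by rw [h])) l z
  · exfalso
    have h1 : a ≠ b := fun h => hxy (by rw [h])
    have h2 : a ≠ c := fun h => hxz (by rw [h])
    have h3 : b ≠ c := fun h => hyz (by rw [h])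
    omega

end HananiFourth

/-! ### Comparison with the construction, and the new tour -/

namespace HananiFourth

variable {n k : ℕ} {E₀ : Type*} {P : ℕ → Set (Sym2 (ZMod (n - 2)))}
  {B₀ : E₀ → Finset (OldPoint n)}

theorem card_block (hP : IsPairSystem (n - 2) (4 * k + 2) P) (hn : n = 12 * k + 10)
    (hB₀ : ∀ e, (B₀ e).card = 4) (e : Index n k E₀ P) : (block B₀ e).card = 4 := by
  rcases e with ⟨i, e⟩ | ⟨a, x, y⟩ | ⟨i, d, w, b⟩ | ⟨i, ⟨⟨α, p, p'⟩, hα, hp, hp'⟩⟩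
  · rw [block, Finset.card_image_of_injective _ (prefixPoint_injective i), hB₀]
  · simp only [block]
    rw [Finset.card_insert_of_notMem (by simp), Finset.card_insert_of_notMem (by simp),
      Finset.card_insert_of_notMem (by simp), Finset.card_singleton]
  · have hi := layer_ne i
    have hd : ((2 * d + 1 : ℕ) : ZMod (n - 2)) ≠ 0 := by
      intro h
      rw [← Nat.cast_zero] at h
      have := natCast_inj (by omega) (by omega) h
      omega
    simp only [block]
    rw [Finset.card_insert_of_notMem, Finset.card_insert_of_notMem,
      Finset.card_insert_of_notMem, Finset.card_singleton]
    · simp [hi.1.symm]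
    · simp only [Finset.mem_insert, Finset.mem_singleton, pt_inj, hi.1.symm, false_and, or_false,
        true_and]
      exact fun h => hd (left_eq_add.1 h)
    · simp [hi.2.1, hi.2.2.1.symm]
  · have hi := layer_ne i
    have hinj : ∀ j : Fin 3, Function.Injective (pt j : ZMod (n - 2) → NewPoint n) :=
      fun j x y h => (pt_inj.1 h).2
    have hdiag : ∀ p ∈ P α, p.toFinset.card = 2 := by
      intro p hp
      refine Sym2.card_toFinset_of_not_isDiag p fun hd => ?_
      induction p using Sym2.ind with
      | _ x y =>
        obtain rfl : x = y := hd
        exact hP.loopless α (by omega) x hp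
    simp only [block]
    rw [Finset.card_union_of_disjoint, Finset.card_image_of_injective _ (hinj _),
      Finset.card_image_of_injective _ (hinj _), hdiag p hp, hdiag p' hp']
    rw [Finset.disjoint_left]
    simp only [Finset.mem_image]
    rintro _ ⟨x, -, rfl⟩ ⟨y, -, h⟩
    exact hi.1 (pt_inj.1 h).1

theorem range_block {B : Set (Finset (OldPoint n))} (hB : Set.range B₀ = B) :
    Set.range (block B₀ : Index n k E₀ P → Finset (NewPoint n)) = fourthConstruction n k B P := by
  subst hB
  ext c
  simp only [fourthConstruction, Set.mem_union, Set.mem_ofPred_eq, Set.mem_range]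
  constructor
  · rintro ⟨⟨i, e⟩ | ⟨a, x, y⟩ | ⟨i, d, w, b⟩ | ⟨i, ⟨⟨α, p, p'⟩, hα, hp, hp'⟩⟩, rfl⟩
    · exact Or.inl (Or.inl (Or.inl ⟨i, _, ⟨e, rfl⟩, rfl⟩))
    · exact Or.inl (Or.inl (Or.inr ⟨a, x, y, _, by ring, rfl⟩))
    · refine Or.inl (Or.inr ⟨i, base n k i d w, b, -(base n k i d w + b), d, by ring, by omega, ?_⟩)
      have h1 : base n k i d w + ((2 * k + 1 + i.val * (4 * k + 2) : ℕ) : ZMod (n - 2)) -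
          ((d : ℕ) : ZMod (n - 2)) = w := by
        simp only [base]
        ring
      have h2 : base n k i d w + ((2 * k + 2 + i.val * (4 * k + 2) : ℕ) : ZMod (n - 2)) +
          ((d : ℕ) : ZMod (n - 2)) = w + ((2 * d + 1 : ℕ) : ZMod (n - 2)) := by
        simp only [base]
        push_cast
        ring
      rw [h1, h2, block]
    · induction p using Sym2.ind with
      | _ r s =>
        induction p' using Sym2.ind with
        | _ r' s' =>
          refine Or.inr ⟨i, α, r, s, r', s', hα.1, hα.2, hp, hp', ?_⟩
          ext z
          simp [block]
          grind
  · rintro (((⟨i, _, ⟨e, rfl⟩, rfl⟩ | ⟨a, x, y, z, h, rfl⟩) | ⟨i, b₁, b₂, b₃, d, h, hd, rfl⟩) |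
      ⟨i, α, r, s, r', s', h1, h2, hp, hp', rfl⟩)
    · exact ⟨Sum.inl (i, e), rfl⟩
    · refine ⟨Sum.inr (Sum.inl (a, x, y)), ?_⟩
      obtain rfl : z = -((a.val : ZMod (n - 2)) + x + y) := by linear_combination h
      rfl
    · refine ⟨Sum.inr (Sum.inr (Sum.inl (i, ⟨d, by omega⟩, b₁ +
        ((2 * k + 1 + i.val * (4 * k + 2) : ℕ) : ZMod (n - 2)) - (d : ZMod (n - 2)), b₂))), ?_⟩
      have hb : base n k i d (b₁ + ((2 * k + 1 + i.val * (4 * k + 2) : ℕ) : ZMod (n - 2)) -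
          (d : ZMod (n - 2))) = b₁ := by
        simp only [base]
        ring
      obtain rfl : b₃ = -(b₁ + b₂) := by linear_combination h
      simp only [block, hb]
      -- The two points in layer `i` differ by `(2k + 2 + d) - (2k + 1 - d) = 2d + 1`.
      congr 4
      push_cast
      ring
    · refine ⟨Sum.inr (Sum.inr (Sum.inr (i, ⟨(α, s(r, s), s(r', s')), ⟨h1, h2⟩, hp, hp'⟩))), ?_⟩
      ext z
      simp [block]
      grind

/-- The tail of a block. -/
noncomputable def tail (t : E₀ → OldPoint n) : Index n k E₀ P → NewPoint n
  | Sum.inl (i, e) => prefixPoint i (t e)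
  | Sum.inr (Sum.inl (a, x, y)) => if a = 0 then pt 0 x else pt 1 y
  | Sum.inr (Sum.inr (Sum.inl (i, _, w, _))) => pt i w
  | Sum.inr (Sum.inr (Sum.inr (i, q))) => pt i q.1.2.1.out.1

/-- The head of a block. -/
noncomputable def head (t : E₀ → OldPoint n) : Index n k E₀ P → NewPoint n
  | Sum.inl (i, e) => prefixPoint i (t e)
  | Sum.inr (Sum.inl (a, x, y)) => if a = 0 then pt 1 y else pt 0 x
  | Sum.inr (Sum.inr (Sum.inl (i, d, w, _))) => pt i (w + ((2 * d + 1 : ℕ) : ZMod (n - 2)))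
  | Sum.inr (Sum.inr (Sum.inr (i, q))) => pt (i + 1) q.1.2.2.out.1

/-- The successor of a block. -/
def next (σ : Equiv.Perm E₀) : Equiv.Perm (Index n k E₀ P) where
  toFun
    | Sum.inl (i, e) => Sum.inl (i, σ e)
    | Sum.inr (Sum.inl (a, x, y)) => Sum.inr (Sum.inl (a + 1, x, y))
    | Sum.inr (Sum.inr (Sum.inl (i, d, w, b))) =>
      Sum.inr (Sum.inr (Sum.inl (i, d, w + ((2 * d + 1 : ℕ) : ZMod (n - 2)), b)))
    | Sum.inr (Sum.inr (Sum.inr (i, q))) =>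
      Sum.inr (Sum.inr (Sum.inr (i + 1, ⟨(q.1.1, q.1.2.2, q.1.2.1), q.2.1, q.2.2.2, q.2.2.1⟩)))
  invFun
    | Sum.inl (i, e) => Sum.inl (i, σ.symm e)
    | Sum.inr (Sum.inl (a, x, y)) => Sum.inr (Sum.inl (a - 1, x, y))
    | Sum.inr (Sum.inr (Sum.inl (i, d, w, b))) =>
      Sum.inr (Sum.inr (Sum.inl (i, d, w - ((2 * d + 1 : ℕ) : ZMod (n - 2)), b)))
    | Sum.inr (Sum.inr (Sum.inr (i, q))) =>
      Sum.inr (Sum.inr (Sum.inr (i - 1, ⟨(q.1.1, q.1.2.2, q.1.2.1), q.2.1, q.2.2.2, q.2.2.1⟩)))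
  left_inv := by
    rintro (⟨i, e⟩ | ⟨a, x, y⟩ | ⟨i, d, w, b⟩ | ⟨i, q⟩) <;> simp
  right_inv := by
    rintro (⟨i, e⟩ | ⟨a, x, y⟩ | ⟨i, d, w, b⟩ | ⟨i, q⟩) <;> simp

/-- If the old system has a tour, some block of it has its tail or its head among the points
other than `A0` and `A1`. -/
theorem exists_inl_end (hn : n = 12 * k + 10) {B : Set (Finset (OldPoint n))} (hB : IsSQS n B)
    (t : BlockTour B E₀) : ∃ e x, t.tail e = Sum.inl x ∨ t.head e = Sum.inl x := by
  have hne : ∀ a b : ℕ, a < 3 → b < 3 → a ≠ b →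
      (Sum.inl (a : ZMod (n - 2)) : OldPoint n) ≠ Sum.inl (b : ZMod (n - 2)) := by
    intro a b ha hb hab h
    exact hab (natCast_inj (by omega) (by omega) (Sum.inl_injective h))
  obtain ⟨e, ⟨h0, h1, h2⟩, -⟩ := hB.existsUnique_index t.bijOn (Sum.inl ((0 : ℕ) : ZMod (n - 2)))
    (Sum.inl ((1 : ℕ) : ZMod (n - 2))) (Sum.inl ((2 : ℕ) : ZMod (n - 2)))
    (hne _ _ (by omega) (by omega) (by omega)) (hne _ _ (by omega) (by omega) (by omega))
    (hne _ _ (by omega) (by omega) (by omega))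
  have h3 := t.tail_mem e
  have h4 := t.head_mem e
  have h5 := t.tail_ne_head e
  refine ⟨e, ?_⟩
  rcases ht : t.tail e with x | a
  · exact ⟨x, Or.inl rfl⟩
  rcases hh : t.head e with x | b
  · exact ⟨x, Or.inr rfl⟩
  rw [ht] at h3 h5
  rw [hh] at h4 h5
  exfalso
  -- With both ends among the `A`s, the block through `0, 1, 2` would have five points.
  have hsub : ({Sum.inl ((0 : ℕ) : ZMod (n - 2)), Sum.inl ((1 : ℕ) : ZMod (n - 2)),
      Sum.inl ((2 : ℕ) : ZMod (n - 2)), Sum.inr a, Sum.inr b} : Finset (OldPoint n)) ⊆ t.blk e := by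
    simp only [Finset.insert_subset_iff, Finset.singleton_subset_iff]
    exact ⟨h0, h1, h2, h3, h4⟩
  have hcard := Finset.card_le_card hsub
  rw [hB.card_block _ (t.bijOn.mapsTo (Set.mem_univ e)), Finset.card_insert_of_notMem,
    Finset.card_insert_of_notMem, Finset.card_insert_of_notMem, Finset.card_insert_of_notMem,
    Finset.card_singleton] at hcard
  · omega
  · simpa using h5
  · simp
  · simpa using hne 1 2 (by omega) (by omega) (by omega)
  · have h6 := hne 0 1 (by omega) (by omega) (by omega)
    have h7 := hne 0 2 (by omega) (by omega) (by omega)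
    simp only [Finset.mem_insert, Finset.mem_singleton, h6, h7, reduceCtorEq, or_self,
      not_false_eq_true]

/-- A set of points that is closed under passing from tails to heads and back contains all points
in the layers or none of them. -/
theorem pt_mem_iff (hP : IsPairSystem (n - 2) (4 * k + 2) P) (hn : n = 12 * k + 10)
    {f g : E₀ → OldPoint n} {T : Set (NewPoint n)}
    (hT : ∀ e : Index n k E₀ P, tail f e ∈ T ↔ head g e ∈ T) (i : Fin 3) (x : ZMod (n - 2)) :
    pt i x ∈ T ↔ pt 0 0 ∈ T := by
  have : NeZero (n - 2) := ⟨by omega⟩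
  have h01 : ∀ x y, (pt 0 x : NewPoint n) ∈ T ↔ pt 1 y ∈ T :=
    fun x y => hT (Sum.inr (Sum.inl (0, x, y)))
  -- Type 3 with `d = 0` has difference 1, which generates `ZMod (n - 2)`.
  have h2 : ∀ w, (pt 2 w : NewPoint n) ∈ T ↔ pt 2 (w + 1) ∈ T := by
    intro w
    have := hT (Sum.inr (Sum.inr (Sum.inl (2, ⟨0, by omega⟩, w, 0))))
    simpa [tail, head] using this
  have h2' : ∀ m : ℕ, (pt 2 (m : ZMod (n - 2)) : NewPoint n) ∈ T ↔ pt 2 0 ∈ T := by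
    intro m
    induction m with
    | zero => simp
    | succ m ih => rw [Nat.cast_add, Nat.cast_one, ← h2, ih]
  have h2'' : ∀ w, (pt 2 w : NewPoint n) ∈ T ↔ pt 2 0 ∈ T := by
    intro w
    rw [← ZMod.natCast_zmod_val w]
    exact h2' _
  -- Any block of type 4 with `i = 1` links layer 1 to layer 2; the first admissible system is used.
  obtain ⟨y, hy, -⟩ := hP.matching (4 * k + 2) (by omega) 0
  have h12 := hT (Sum.inr (Sum.inr (Sum.inr (1, ⟨(4 * k + 2, s(0, y), s(0, y)),
    ⟨le_rfl, by omega⟩, hy, hy⟩))))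
  change (pt 1 _ : NewPoint n) ∈ T ↔ pt 2 _ ∈ T at h12
  fin_cases i
  · exact (h01 x 0).trans (h01 0 0).symm
  · exact (h01 0 x).symm
  · exact ((h2'' x).trans (h2'' _).symm).trans (h12.symm.trans (h01 0 _).symm)

/-- A tour of the old system yields a tour of the new one. -/
noncomputable def tour (hP : IsPairSystem (n - 2) (4 * k + 2) P) (hn : n = 12 * k + 10)
    {B : Set (Finset (OldPoint n))} (hB : IsSQS n B) (t : BlockTour B E₀)
    (hbij : Set.BijOn (block t.blk : Index n k E₀ P → Finset (NewPoint n)) Set.univ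
      (fourthConstruction n k B P)) :
    BlockTour (fourthConstruction n k B P) (Index n k E₀ P) where
  blk := block t.blk
  bijOn := hbij
  tail := tail t.tail
  head := head t.head
  tail_mem := by
    rintro (⟨i, e⟩ | ⟨a, x, y⟩ | ⟨i, d, w, b⟩ | ⟨i, q⟩)
    · exact Finset.mem_image_of_mem _ (t.tail_mem e)
    · simp only [tail]
      split_ifs <;> simp
    · simp [tail]
    · exact (pt_mem_block₄ _).2 (Or.inl ⟨rfl, Sym2.out_fst_mem _⟩)
  head_mem := by
    rintro (⟨i, e⟩ | ⟨a, x, y⟩ | ⟨i, d, w, b⟩ | ⟨i, q⟩)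
    · exact Finset.mem_image_of_mem _ (t.head_mem e)
    · simp only [head]
      split_ifs <;> simp
    · simp [head]
    · exact (pt_mem_block₄ _).2 (Or.inr ⟨rfl, Sym2.out_fst_mem _⟩)
  tail_ne_head := by
    rintro (⟨i, e⟩ | ⟨a, x, y⟩ | ⟨i, d, w, b⟩ | ⟨i, q⟩)
    · exact (prefixPoint_injective i).ne (t.tail_ne_head e)
    · simp only [tail, head]
      split_ifs <;> simp
    · intro h
      have h1 := (pt_inj.1 h).2
      rw [left_eq_add, ← Nat.cast_zero] at h1
      have := natCast_inj (by omega) (by omega) h1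
      omega
    · intro h
      exact (layer_ne i).1 (pt_inj.1 h).1.symm
  next := next t.next
  head_eq := by
    -- In type 4 the end chosen by `out` depends only on the unordered pair, so it is the same when
    -- that pair moves from second to first place.
    rintro (⟨i, e⟩ | ⟨a, x, y⟩ | ⟨i, d, w, b⟩ | ⟨i, q⟩)
    · simp [head, next, tail, t.head_eq]
    · fin_cases a <;> simp [head, next, tail]
    · simp [head, next, tail]
    · simp [head, next, tail]
  connected := by
    intro T hT
    have hpt := pt_mem_iff hP hn hT
    have key : ∀ e : Index n k E₀ P, tail t.tail e ∈ T ↔ pt 0 0 ∈ T := by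
      rintro (⟨i, e⟩ | ⟨a, x, y⟩ | ⟨i, d, w, b⟩ | ⟨i, q⟩)
      · obtain ⟨e₁, x, hx⟩ := exists_inl_end hn hB t
        have hT' : ∀ e, t.tail e ∈ prefixPoint i ⁻¹' T ↔ t.head e ∈ prefixPoint i ⁻¹' T :=
          fun e => hT (Sum.inl (i, e))
        have h1 : prefixPoint i (t.tail e₁) ∈ T ↔ pt 0 0 ∈ T := by
          rcases hx with hx | hx
          · rw [hx]
            exact hpt i x
          · rw [← hpt i x, ← Set.mem_preimage, hT', hx]
            rfl
        rw [← h1]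
        exact ⟨t.connected _ hT' e e₁, t.connected _ hT' e₁ e⟩
      · simp only [tail]
        split_ifs <;> exact hpt _ _
      · exact hpt _ _
      · exact hpt _ _
    intro e e' he
    exact (key e').2 ((key e).1 he)

theorem isSQS_and_admitsOcycle (hP : IsPairSystem (n - 2) (4 * k + 2) P) (hn : n = 12 * k + 10)
    {B : Set (Finset (OldPoint n))} (hB : IsSQS n B) (hC : AdmitsOcycle 1 B) :
    IsSQS (3 * n - 4) (fourthConstruction n k B P) ∧
      AdmitsOcycle 1 (fourthConstruction n k B P) := by
  have : NeZero (n - 2) := ⟨by omega⟩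
  obtain ⟨N, ⟨t⟩⟩ := hC.exists_blockTour hB.card_block
  have hrange : Set.range t.blk = B := by
    rw [← Set.image_univ]
    exact t.bijOn.image_eq
  have hcard : Nat.card (NewPoint n) = 3 * n - 4 := by
    rw [Nat.card_sum, Nat.card_prod, Nat.card_zmod, Nat.card_fin, Nat.card_fin]
    omega
  obtain ⟨h1, h2⟩ := isSQS_of_existsUnique hcard (range_block (P := P) (k := k) hrange)
    (card_block hP hn fun e => hB.card_block _ (t.bijOn.mapsTo (Set.mem_univ e)))
    (inUniqueBlock hP hn (hB.existsUnique_index t.bijOn))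
  have t' := tour hP hn hB t h2
  have := t'.finite
  have : Nonempty (Index n k (Fin N) P) := ⟨Sum.inr (Sum.inl (0, 0, 0))⟩
  exact ⟨h1, t'.admitsOcycle⟩

end HananiFourth

theorem mainTheorem5 {X : Type*} [DecidableEq X] (n : ℕ) (hn : n ≡ 10 [MOD 12])
    (B : Set (Finset X)) (hB : IsSQS n B) (hC : AdmitsOcycle 1 B) :
    (∃ C : Set (Finset (Fin (3 * n - 4))), IsSQS (3 * n - 4) C ∧ AdmitsOcycle 1 C) ∧
    ∀ k : ℕ, n = 12 * k + 10 →
      (∃ P : ℕ → Set (Sym2 (ZMod (n - 2))), IsPairSystem (n - 2) (4 * k + 2) P) ∧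
      ∀ (e : X ≃ OldPoint n) (P : ℕ → Set (Sym2 (ZMod (n - 2)))),
        IsPairSystem (n - 2) (4 * k + 2) P →
          IsSQS (3 * n - 4) (fourthConstruction n k (relabel e B) P) ∧
          AdmitsOcycle 1 (fourthConstruction n k (relabel e B) P) := by
  have main : ∀ k : ℕ, n = 12 * k + 10 →
      (∃ P : ℕ → Set (Sym2 (ZMod (n - 2))), IsPairSystem (n - 2) (4 * k + 2) P) ∧
      ∀ (e : X ≃ OldPoint n) (P : ℕ → Set (Sym2 (ZMod (n - 2)))),
        IsPairSystem (n - 2) (4 * k + 2) P →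
          IsSQS (3 * n - 4) (fourthConstruction n k (relabel e B) P) ∧
          AdmitsOcycle 1 (fourthConstruction n k (relabel e B) P) := fun k hk =>
    ⟨exists_isPairSystem _ k (by omega), fun e _ hP =>
      HananiFourth.isSQS_and_admitsOcycle hP hk (hB.map e) (hC.map e)⟩
  refine ⟨?_, main⟩
  obtain ⟨k, hk⟩ : ∃ k, n = 12 * k + 10 := by
    have : n % 12 = 10 % 12 := hn
    exact ⟨n / 12, by omega⟩
  have : NeZero (n - 2) := ⟨by omega⟩
  have := hB.finite
  obtain ⟨⟨P, hP⟩, h⟩ := main k hk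
  have hX : Nat.card X = Nat.card (OldPoint n) := by
    rw [hB.card_points, Nat.card_sum, Nat.card_zmod, Nat.card_fin]
    omega
  -- For bare existence any labelling of the old points serves, and the result is carried over to
  -- `Fin (3 * n - 4)`.
  obtain ⟨e⟩ := Finite.card_eq.1 hX
  obtain ⟨h1, h2⟩ := h e P hP
  have hY : Nat.card (NewPoint n) = Nat.card (Fin (3 * n - 4)) := by
    rw [h1.card_points, Nat.card_fin]
  obtain ⟨e'⟩ := Finite.card_eq.1 hY
  exact ⟨_, h1.map e', h2.map e'⟩
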